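/- **Setting.** The domain consists of the integers together with names (finite binary strings). A relational schema has finitely many relation symbols; every relation has a primary key and a set of integer-valued *fixable* attributes, disjoint from the key; the other attributes are *rigid*. An instance $D$ is a finite set of tuples for each relation that satisfies the key constraints. A *one database atom denial* (1AD) is a sentence $\forall \bar x\,\neg(A\wedge B)$, where $A$ is a database atom and $B$ is a conjunction of built-in atoms $x\,\theta\,c$ (with $\theta\in\{=,\neq,<,>,\le,\ge\}$ and $c$ a constant) and $x=y$ over variables of $A$. For a finite set $IC$ of 1ADs, a *fix* of $D$ is an instance $D'$ that satisfies $IC$ and is obtained from $D$ by changing values of fixable attributes only (to integers); an *LS-fix* is a fix $D'$ that minimizes $\Delta(D,D')$, the sum of the squares of all the changes. A scalar conjunctive query with sum, $Q(\mathrm{sum}(z))\leftarrow A_1,\dots,A_m,B_1,\dots,B_l$ (database atoms $A_i$, comparisons $B_j$ between variables and constants, every variable occurring in some $A_i$) has in $D'$ the answer $Q(D')=\sum_\beta\beta(z)$, where $\beta$ runs over the assignments to all the variables of the body that make the body true in $D'$. The *min-max answer* to $Q$ in $D$ is $\sup\{Q(D') : D' \text{ an LS-fix of } D\}$. **Theorem.**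 Fix a schema, a finite set $IC$ of 1ADs and a scalar conjunctive query $Q$ with sum and $m$ database atoms. There is a least natural number $k$ such that, for every instance $D$ and every tuple $t$ of $D$, at most $k$ tuples replace $t$ in the LS-fixes of $D$ (so $k$ is the maximal number of fixes of a tuple; it depends on the schema and $IC$, and not on $D$). There is an algorithm which, on every instance $D$, halts after a number of steps that is polynomial in the size of $D$ (numbers are written in binary) and which has the following property: if $D$ has an LS-fix, and the aggregation variable $z$ takes only non-negative integer values under the assignments that satisfy the body of $Q$ in LS-fixes of $D$, then the min-max answer $\mathrm{opt}$ to $Q$ in $D$ exists, and the output is an LS-fix $D^*$ of $D$ together with the value $v=Q(D^*)$, such that $$v\;\le\;\mathrm{opt}\;\le\;k^{m}\,v ,$$ that is, the min-max answer is approximated within the factor $k^{-m}$. -/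

import Mathlib

/-! ### Constants, schemas and instances -/

/-- The domain: the integers together with uninterpreted names (strings over a binary alphabet). -/
inductive Const where
  | num (z : ℤ) : Const
  | sym (s : List Bool) : Const
  deriving DecidableEq

/-- The integer value of a numerical constant (names have the default value `0`, which is never
used: fixable attributes hold integers, and the aggregated values are assumed to be integers). -/
def Const.toInt : Const → ℤ
  | .num z => z
  | .sym _ => 0

/-- A relational schema: finitely many relation symbols, each with its attributes (positions), a
primary key and a set of fixable attributes. The key attributes are rigid. -/
structure Schema where
  numRel : ℕ
  arity : Fin numRel → ℕ
  key : ∀ R, Finset (Fin (arity R))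
  fixable : ∀ R, Finset (Fin (arity R))
  key_rigid : ∀ R, Disjoint (key R) (fixable R)

/-- Tuples of constants for the relation `R`. -/
abbrev Row (S : Schema) (R : Fin S.numRel) : Type := Fin (S.arity R) → Const

/-- Ground atoms `R(t)`. -/
abbrev DBFact (S : Schema) : Type := Σ R : Fin S.numRel, Row S R

/-- A database: a finite set of tuples for each relation symbol. -/
abbrev Database (S : Schema) : Type := ∀ R : Fin S.numRel, Finset (Row S R)

/-- Two tuples of a relation have the same key value. -/
def SameKey {S : Schema} {R : Fin S.numRel} (t t' : Row S R) : Prop :=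
  ∀ A ∈ S.key R, t A = t' A

instance {S : Schema} {R : Fin S.numRel} (t t' : Row S R) : Decidable (SameKey t t') :=
  inferInstanceAs (Decidable (∀ A ∈ S.key R, t A = t' A))

/-- A legal instance: fixable attributes take integer values, and the key constraints hold. -/
structure IsInstance {S : Schema} (D : Database S) : Prop where
  typed : ∀ R, ∀ t ∈ D R, ∀ A ∈ S.fixable R, ∃ z : ℤ, t A = Const.num z
  keys : ∀ R, ∀ t ∈ D R, ∀ t' ∈ D R, SameKey t t' → t = t'

/-! ### Atoms, denials and queries -/

/-- Terms over the variables `x₀, …, xₙ₋₁`. -/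
inductive Trm (n : ℕ) where
  | var (x : Fin n) : Trm n
  | const (c : Const) : Trm n

def Trm.eval {n : ℕ} (β : Fin n → Const) : Trm n → Const
  | .var x => β x
  | .const c => c

/-- Database atoms `R(τ₁, …, τᵣ)`. -/
structure DBAtom (S : Schema) (n : ℕ) where
  rel : Fin S.numRel
  args : Fin (S.arity rel) → Trm n

/-- The variable `x` occurs in the database atom. -/
def DBAtom.Occurs {S : Schema} {n : ℕ} (a : DBAtom S n) (x : Fin n) : Prop :=
  ∃ A, a.args A = Trm.var x

/-- The atom is true in `D` under the assignment `β`. -/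
def DBAtom.Holds {S : Schema} {n : ℕ} (a : DBAtom S n) (D : Database S) (β : Fin n → Const) :
    Prop :=
  (fun A => (a.args A).eval β) ∈ D a.rel

/-- The comparison operators `=, ≠, <, >, ≤, ≥`. -/
inductive Cmp where
  | eq | ne | lt | gt | le | ge

/-- Truth of a comparison; the order comparisons are between integers only. -/
def Cmp.Holds : Cmp → Const → Const → Prop
  | .eq, a, b => a = b
  | .ne, a, b => a ≠ b
  | .lt, .num a, .num b => a < b
  | .gt, .num a, .num b => a > b
  | .le, .num a, .num b => a ≤ b
  | .ge, .num a, .num b => a ≥ b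
  | _, _, _ => False

/-- The built-in atoms of linear denials: `x θ c` and `x = y`. -/
inductive DenialBuiltin (n : ℕ) where
  | cmp (θ : Cmp) (x : Fin n) (c : Const) : DenialBuiltin n
  | eq (x y : Fin n) : DenialBuiltin n

def DenialBuiltin.Holds {n : ℕ} (β : Fin n → Const) : DenialBuiltin n → Prop
  | .cmp θ x c => θ.Holds (β x) c
  | .eq x y => β x = β y

def DenialBuiltin.Occurs {n : ℕ} (z : Fin n) : DenialBuiltin n → Prop
  | .cmp _ x _ => z = x
  | .eq x y => z = x ∨ z = y

/-- One database atom denials `∀ x̄ ¬(A ∧ B)`: `A` is a database atom, `B` a conjunction of built-in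
atoms, and the variables of `B` occur in `A`. -/
structure OneAtomDenial (S : Schema) where
  n : ℕ
  atom : DBAtom S n
  builtins : List (DenialBuiltin n)
  safe : ∀ b ∈ builtins, ∀ x, b.Occurs x → atom.Occurs x

/-- `D ⊨ ic`. -/
def OneAtomDenial.Sat {S : Schema} (ic : OneAtomDenial S) (D : Database S) : Prop :=
  ∀ β : Fin ic.n → Const, ¬ (ic.atom.Holds D β ∧ ∀ b ∈ ic.builtins, b.Holds β)

/-- A scalar conjunctive query with sum, `q(sum(z)) ← A₁, …, Aₘ, B₁, …, Bₗ`, with database atoms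
`Aᵢ` and built-in atoms `Bⱼ` of the form `τ θ τ'`. All variables occur in database atoms. -/
structure SumQuery (S : Schema) where
  n : ℕ
  atoms : List (DBAtom S n)
  builtins : List (Cmp × Trm n × Trm n)
  aggVar : Fin n
  safe : ∀ x, ∃ a ∈ atoms, a.Occurs x

/-- The assignments to all the variables of the body that make the body true in `D`. -/
def SumQuery.matches {S : Schema} (q : SumQuery S) (D : Database S) : Set (Fin q.n → Const) :=
  {β | (∀ a ∈ q.atoms, a.Holds D β) ∧ ∀ b ∈ q.builtins, b.1.Holds (b.2.1.eval β) (b.2.2.eval β)}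

theorem SumQuery.matches_finite {S : Schema} (q : SumQuery S) (D : Database S) :
    (q.matches D).Finite := by
  classical
  let dom : Finset Const :=
    Finset.univ.biUnion fun R => (D R).biUnion fun t => Finset.univ.image t
  refine (Fintype.piFinset fun _ : Fin q.n => dom).finite_toSet.subset ?_
  intro β hβ
  simp only [Finset.mem_coe, Fintype.mem_piFinset]
  intro x
  obtain ⟨a, ha, A, hA⟩ := q.safe x
  have h := hβ.1 a ha
  simp only [dom, Finset.mem_biUnion, Finset.mem_univ, true_and, Finset.mem_image]
  exact ⟨a.rel, _, h, A, by simp [hA, Trm.eval]⟩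

/-- The answer to the query in `D`: the sum of the values of the aggregation variable over all the
assignments that satisfy the body. -/
noncomputable def SumQuery.answer {S : Schema} (q : SumQuery S) (D : Database S) : ℤ :=
  ∑ β ∈ (q.matches_finite D).toFinset, (β q.aggVar).toInt

/-! ### Least squares fixes -/

/-- The square distance: for each key value occurring in both databases, the squares of the changes
of the fixable attributes are added up (all attributes have weight `1`). -/
def sqDist {S : Schema} (D D' : Database S) : ℤ :=
  ∑ R, ∑ t ∈ D R, ∑ t' ∈ (D' R).filter (fun t' => SameKey t t'), ∑ A ∈ S.fixable R,
    ((t A).toInt - (t' A).toInt) ^ 2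

/-- `D'` is a fix of `D` with respect to the constraints `IC`: a legal instance that satisfies `IC`
and has the same values as `D` in all the rigid attributes. -/
structure IsFix {S : Schema} (IC : Finset (OneAtomDenial S)) (D D' : Database S) : Prop where
  isInstance : IsInstance D'
  rigid_left : ∀ R, ∀ t ∈ D R, ∃ t' ∈ D' R, ∀ A, A ∉ S.fixable R → t' A = t A
  rigid_right : ∀ R, ∀ t' ∈ D' R, ∃ t ∈ D R, ∀ A, A ∉ S.fixable R → t' A = t A
  sat : ∀ ic ∈ IC, ic.Sat D'

/-- Least squares fixes: the fixes at minimum square distance. -/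
def IsLSFix {S : Schema} (IC : Finset (OneAtomDenial S)) (D D' : Database S) : Prop :=
  IsFix IC D D' ∧ ∀ D'', IsFix IC D D'' → sqDist D D' ≤ sqDist D D''

/-- The fixes of a tuple `t` of `D`: the tuples that replace `t` in the LS-fixes of `D`. -/
def tupleFixes {S : Schema} (IC : Finset (OneAtomDenial S)) (D : Database S) {R : Fin S.numRel}
    (t : Row S R) : Set (Row S R) :=
  {t' | SameKey t t' ∧ ∃ D', IsLSFix IC D D' ∧ t' ∈ D' R}

/-- `k` bounds the number of fixes of a tuple, uniformly over all instances. -/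
def BoundsTupleFixes {S : Schema} (IC : Finset (OneAtomDenial S)) (k : ℕ) : Prop :=
  ∀ D : Database S, IsInstance D → ∀ R, ∀ t ∈ D R, (tupleFixes IC D t).encard ≤ k

/-- The aggregation variable takes only non-negative integer values in the LS-fixes of `D`. -/
def SumQuery.NonnegOn {S : Schema} (q : SumQuery S) (IC : Finset (OneAtomDenial S))
    (D : Database S) : Prop :=
  ∀ D', IsLSFix IC D D' → ∀ β ∈ q.matches D', ∃ w : ℕ, β q.aggVar = Const.num w

/-- The min-max answer under the range semantics is the supremum of the answers to the query in the
LS-fixes of `D`. -/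
def SumQuery.IsMinMaxAnswer {S : Schema} (q : SumQuery S) (IC : Finset (OneAtomDenial S))
    (D : Database S) (a : ℤ) : Prop :=
  IsLUB {v | ∃ D', IsLSFix IC D D' ∧ q.answer D' = v} a

/-! ### The machine model

First-order functional programs over binary trees (pure LISP), with an explicit step count. Trees are
handled as pointers to shared cells, so that every step is a bounded number of elementary pointer
operations; polynomial time in this model is polynomial time on Turing machines. Integers are not
primitive: they are lists of bits, and all arithmetic has to be programmed. -/

/-- Binary trees, the data of the programs. -/
inductive Data where
  | nil : Data
  | cons (a b : Data) : Data

/-- The number of nodes of a tree. -/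
def Data.size : Data → ℕ
  | .nil => 1
  | .cons a b => a.size + b.size + 1

/-- Expressions. Variables are de Bruijn indices into the list of current values. -/
inductive Expr where
  | var (i : ℕ) : Expr
  | nil : Expr
  | cons (e₁ e₂ : Expr) : Expr
  | letIn (e₁ e₂ : Expr) : Expr
  | cases (e eNil eCons : Expr) : Expr
  | call (f : ℕ) (e : Expr) : Expr

/-- `Eval F env e v s`: in the environment `env`, the expression `e` has the value `v`, and its
evaluation takes `s` steps. `F` is the list of the bodies of the unary, possibly mutually recursive
functions of the program. -/
inductive Eval (F : List Expr) : List Data → Expr → Data → ℕ → Prop where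
  | var (env : List Data) (i : ℕ) (v : Data) :
      env[i]? = some v → Eval F env (.var i) v 1
  | nil (env : List Data) : Eval F env .nil .nil 1
  | cons (env : List Data) (e₁ e₂ : Expr) (v₁ v₂ : Data) (s₁ s₂ : ℕ) :
      Eval F env e₁ v₁ s₁ → Eval F env e₂ v₂ s₂ →
      Eval F env (.cons e₁ e₂) (.cons v₁ v₂) (s₁ + s₂ + 1)
  | letIn (env : List Data) (e₁ e₂ : Expr) (v₁ v₂ : Data) (s₁ s₂ : ℕ) :
      Eval F env e₁ v₁ s₁ → Eval F (v₁ :: env) e₂ v₂ s₂ →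
      Eval F env (.letIn e₁ e₂) v₂ (s₁ + s₂ + 1)
  | casesNil (env : List Data) (e eNil eCons : Expr) (v : Data) (s₁ s₂ : ℕ) :
      Eval F env e .nil s₁ → Eval F env eNil v s₂ →
      Eval F env (.cases e eNil eCons) v (s₁ + s₂ + 1)
  | casesCons (env : List Data) (e eNil eCons : Expr) (a b v : Data) (s₁ s₂ : ℕ) :
      Eval F env e (.cons a b) s₁ → Eval F (a :: b :: env) eCons v s₂ →
      Eval F env (.cases e eNil eCons) v (s₁ + s₂ + 1)
  | call (env : List Data) (f : ℕ) (e body : Expr) (a v : Data) (s₁ s₂ : ℕ) :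
      F[f]? = some body → Eval F env e a s₁ → Eval F [a] body v s₂ →
      Eval F env (.call f e) v (s₁ + s₂ + 1)

/-- A program: finitely many function bodies, and a main expression with one free variable. -/
structure Program where
  functions : List Expr
  main : Expr

/-- On input `x`, the program halts after `s` steps with the output `y`. -/
def Program.Runs (P : Program) (x y : Data) (s : ℕ) : Prop :=
  Eval P.functions [x] P.main y s

/-- Evaluation is deterministic: the output and the number of steps are determined by the input. -/
theorem Eval.deterministic {F : List Expr} {env : List Data} {e : Expr} {v v' : Data} {s s' : ℕ}
    (h : Eval F env e v s) (h' : Eval F env e v' s') : v = v' ∧ s = s' := by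
  induction h generalizing v' s' with
  | var env i v hv => cases h' with | var _ _ _ hv' => simp_all
  | nil env => cases h'; simp
  | cons env e₁ e₂ v₁ v₂ s₁ s₂ _ _ ih₁ ih₂ =>
    cases h' with
    | cons _ _ _ _ _ _ _ g₁ g₂ =>
      obtain ⟨rfl, rfl⟩ := ih₁ g₁
      obtain ⟨rfl, rfl⟩ := ih₂ g₂
      simp
  | letIn env e₁ e₂ v₁ v₂ s₁ s₂ _ _ ih₁ ih₂ =>
    cases h' with
    | letIn _ _ _ _ _ _ _ g₁ g₂ =>
      obtain ⟨rfl, rfl⟩ := ih₁ g₁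
      obtain ⟨rfl, rfl⟩ := ih₂ g₂
      simp
  | casesNil env e eNil eCons v s₁ s₂ _ _ ih₁ ih₂ =>
    cases h' with
    | casesNil _ _ _ _ _ _ _ g₁ g₂ =>
      obtain ⟨-, rfl⟩ := ih₁ g₁
      obtain ⟨rfl, rfl⟩ := ih₂ g₂
      simp
    | casesCons _ _ _ _ _ _ _ _ _ g₁ g₂ => exact absurd (ih₁ g₁).1 (by simp)
  | casesCons env e eNil eCons a b v s₁ s₂ _ _ ih₁ ih₂ =>
    cases h' with
    | casesNil _ _ _ _ _ _ _ g₁ g₂ => exact absurd (ih₁ g₁).1 (by simp)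
    | casesCons _ _ _ _ _ _ _ _ _ g₁ g₂ =>
      obtain ⟨h1, rfl⟩ := ih₁ g₁
      obtain ⟨rfl, rfl⟩ := Data.cons.inj h1
      obtain ⟨rfl, rfl⟩ := ih₂ g₂
      simp
  | call env f e body a v s₁ s₂ hb _ _ ih₁ ih₂ =>
    cases h' with
    | call _ _ _ body' _ _ _ _ hb' g₁ g₂ =>
      obtain rfl : body = body' := by simpa [hb] using hb'
      obtain ⟨rfl, rfl⟩ := ih₁ g₁
      obtain ⟨rfl, rfl⟩ := ih₂ g₂
      simp

/-! ### Databases as inputs; numbers are written in binary -/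

def encodeBool : Bool → Data
  | false => .nil
  | true => .cons .nil .nil

def encodeList {α : Type} (enc : α → Data) : List α → Data
  | [] => .nil
  | a :: l => .cons (enc a) (encodeList enc l)

/-- The list of the binary digits, the least significant digit first. -/
def encodeNat (n : ℕ) : Data := encodeList encodeBool n.bits

/-- Sign and absolute value. -/
def encodeInt (z : ℤ) : Data := .cons (encodeBool (decide (z < 0))) (encodeNat z.natAbs)

def encodeConst : Const → Data
  | .num z => .cons (encodeBool false) (encodeInt z)
  | .sym s => .cons (encodeBool true) (encodeList encodeBool s)

def encodeFact {S : Schema} (f : DBFact S) : Data :=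
  .cons (encodeNat f.1) (encodeList encodeConst (List.ofFn f.2))

def encodeFacts {S : Schema} (l : List (DBFact S)) : Data := encodeList encodeFact l

/-- `l` lists the facts of `D`, each of them once. -/
def ListsFacts {S : Schema} (l : List (DBFact S)) (D : Database S) : Prop :=
  l.Nodup ∧ ∀ (R : Fin S.numRel) (t : Row S R), (⟨R, t⟩ : DBFact S) ∈ l ↔ t ∈ D R

/-! A one-atom denial inspects a single tuple, and keys are rigid. So the fixes of `D` arise by
replacing every tuple independently by a locally consistent one, and the square distance is the sum
of the distances of the tuples. The LS-fixes are therefore the independent choices of a nearest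
replacement for each tuple (`isLSFix_replaceRows_iff`).

In a nearest replacement, every fixable value lies within the arity of the old value or of a
constant of the denials (`IsLocalLSFix.value_near`). Otherwise it could be moved a few units towards
the old value, skipping the other values of the tuple, without creating a violation. So the nearest
replacements of a tuple, its block, lie among candidates whose number is bounded independently of
`D`. This yields `k` and makes the blocks computable.

Now choose uniformly and independently from every block. An assignment that satisfies the body in
some LS-fix uses at most `m` facts, each chosen with probability at least `1/k`, and different facts
come from different blocks. So it survives with probability at least `k⁻ᵐ`. Since the weights are
non-negative, the expected answer is at least `k⁻ᵐ` times the total weight of all such assignments,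
and this total bounds the answer in every LS-fix.

The choice is derandomized by conditional expectations. `potential` is a lower estimate of the
conditional expectation, scaled by `kᵐ`. Some element of the next block does not decrease it
(`exists_potential_le`), so the greedy choice leads from the total weight to `kᵐ v` (`greedy_spec`).

The schema, the denials and the query are fixed, so there are only polynomially many assignments to
consider. `PTime` is closed under composition and under recursion, with polynomially bounded values,
along lists and binary digits; the algorithm is assembled from these operations. -/

/-! ### Polynomial-time functions -/

/-- Types whose elements are represented by trees. -/
class DataEnc (α : Type) where
  enc : α → Data
  inj : Function.Injective enc

open DataEnc (enc)

theorem encodeBool_injective : Function.Injective encodeBool := by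
  intro a b h
  cases a <;> cases b <;> simp_all [encodeBool]

theorem encodeList_injective {α : Type} {e : α → Data} (he : Function.Injective e) :
    Function.Injective (encodeList e) := by
  intro l
  induction l with
  | nil => intro l' h; cases l' <;> simp_all [encodeList]
  | cons a l ih =>
    intro l' h
    cases l' with
    | nil => simp [encodeList] at h
    | cons a' l' =>
      simp only [encodeList, Data.cons.injEq] at h
      rw [he h.1, ih h.2]

theorem encodeNat_injective : Function.Injective encodeNat := fun m n h => by
  have h' : m.bits = n.bits := encodeList_injective encodeBool_injective h
  rw [← Nat.digits_inj_iff (b := 2), Nat.digits_two_eq_bits, Nat.digits_two_eq_bits, h']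

theorem encodeInt_injective : Function.Injective encodeInt := fun x y h => by
  simp only [encodeInt, Data.cons.injEq] at h
  have h1 := encodeBool_injective h.1
  have h2 := encodeNat_injective h.2
  simp only [decide_eq_decide] at h1
  omega

theorem encodeConst_injective : Function.Injective encodeConst := by
  intro a b h
  cases a <;> cases b <;> simp only [encodeConst, encodeBool, Data.cons.injEq] at h
  · rw [encodeInt_injective h.2]
  · simp at h
  · simp at h
  · rw [encodeList_injective encodeBool_injective h.2]

instance : DataEnc Data := ⟨id, Function.injective_id⟩
instance : DataEnc Unit := ⟨fun _ => .nil, fun _ _ _ => rfl⟩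
instance : DataEnc Bool := ⟨encodeBool, encodeBool_injective⟩
instance : DataEnc ℕ := ⟨encodeNat, encodeNat_injective⟩
instance : DataEnc ℤ := ⟨encodeInt, encodeInt_injective⟩
instance : DataEnc Const := ⟨encodeConst, encodeConst_injective⟩
instance {α : Type} [DataEnc α] : DataEnc (List α) :=
  ⟨encodeList enc, encodeList_injective DataEnc.inj⟩
instance {α β : Type} [DataEnc α] [DataEnc β] : DataEnc (α × β) :=
  ⟨fun x => .cons (enc x.1) (enc x.2), fun x y h => by
    simp only [Data.cons.injEq] at h
    exact Prod.ext (DataEnc.inj h.1) (DataEnc.inj h.2)⟩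

/-- The size of the representation. -/
def esize {α : Type} [DataEnc α] (a : α) : ℕ := (enc a).size

section Size
variable {α β : Type} [DataEnc α] [DataEnc β]

theorem Data.size_pos (d : Data) : 0 < d.size := by cases d <;> simp [Data.size]

theorem esize_pos (a : α) : 0 < esize a := Data.size_pos _

theorem enc_pair (x : α × β) : enc x = .cons (enc x.1) (enc x.2) := rfl

theorem esize_pair (x : α × β) : esize x = esize x.1 + esize x.2 + 1 := rfl

theorem esize_nil : esize ([] : List α) = 1 := rfl

theorem esize_cons (a : α) (l : List α) : esize (a :: l) = esize a + esize l + 1 := rfl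

theorem enc_cons (a : α) (l : List α) : enc (a :: l) = .cons (enc a) (enc l) := rfl

theorem esize_bool_le (b : Bool) : esize b ≤ 3 := by
  cases b <;> simp [esize, enc, encodeBool, Data.size]

end Size

theorem Polynomial.eval_le_eval_of_le (p : Polynomial ℕ) {m n : ℕ} (h : m ≤ n) :
    p.eval m ≤ p.eval n := by
  rw [Polynomial.eval_eq_sum, Polynomial.eval_eq_sum]
  exact Finset.sum_le_sum fun i _ => Nat.mul_le_mul_left _ (Nat.pow_le_pow_left h i)

/-- De Bruijn indices count from the front, so values added at the end shift nothing. This lets code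
written for a single argument run inside larger expressions. -/
theorem Eval.append_env {F : List Expr} {env : List Data} {e : Expr} {v : Data} {s : ℕ}
    (h : Eval F env e v s) (env' : List Data) : Eval F (env ++ env') e v s := by
  induction h with
  | var env i v hv =>
    refine .var _ _ _ ?_
    have := (List.getElem?_eq_some_iff.1 hv).1
    rw [List.getElem?_append_left this, hv]
  | nil env => exact .nil _
  | cons env e₁ e₂ v₁ v₂ s₁ s₂ _ _ ih₁ ih₂ => exact .cons _ _ _ _ _ _ _ ih₁ ih₂
  | letIn env e₁ e₂ v₁ v₂ s₁ s₂ _ _ ih₁ ih₂ => exact .letIn _ _ _ _ _ _ _ ih₁ ih₂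
  | casesNil env e eNil eCons v s₁ s₂ _ _ ih₁ ih₂ => exact .casesNil _ _ _ _ _ _ _ ih₁ ih₂
  | casesCons env e eNil eCons a b v s₁ s₂ _ _ ih₁ ih₂ =>
    exact .casesCons _ _ _ _ _ _ _ _ _ ih₁ ih₂
  | call env f e body a v s₁ s₂ hb _ h₂ ih₁ _ => exact .call _ _ _ _ _ _ _ _ hb ih₁ h₂

/-- The function `f` is computed in polynomial time, and its values have polynomial size. The code
`G` may be placed after any functions `F` and before any functions `H`. -/
def PTime {α β : Type} [DataEnc α] [DataEnc β] (f : α → β) : Prop :=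
  ∃ p : Polynomial ℕ, (∀ a, esize (f a) ≤ p.eval (esize a)) ∧
    ∀ F : List Expr, ∃ (G : List Expr) (e : Expr), ∀ (H : List Expr) (a : α),
      ∃ s ≤ p.eval (esize a), Eval (F ++ G ++ H) [enc a] e (enc (f a)) s

/-! ### Closure properties of polynomial-time functions -/

namespace PTime

variable {α β γ δ : Type} [DataEnc α] [DataEnc β] [DataEnc γ] [DataEnc δ]

theorem size_le {f : α → β} (hf : PTime f) :
    ∃ p : Polynomial ℕ, ∀ a, esize (f a) ≤ p.eval (esize a) := by
  obtain ⟨p, hp, -⟩ := hf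
  exact ⟨p, hp⟩

/-- Programs see only encodings, so the same code serves types with the same representation, such as
a number and its list of bits. -/
theorem congr_enc {α' β' : Type} [DataEnc α'] [DataEnc β'] {f : α → β} (hf : PTime f)
    {g : α' → β'} (φ : α' → α) (h₁ : ∀ a, enc (φ a) = enc a) (h₂ : ∀ a, enc (f (φ a)) = enc (g a)) :
    PTime g := by
  obtain ⟨p, hp, hF⟩ := hf
  refine ⟨p, fun a => ?_, fun F => ?_⟩
  · have := hp (φ a)
    rwa [esize, h₂, esize, h₁] at this
  · obtain ⟨G, e, h⟩ := hF F
    refine ⟨G, e, fun H a => ?_⟩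
    have := h H (φ a)
    rwa [h₂, esize, h₁] at this

protected theorem id : PTime (fun a : α => a) := by
  refine ⟨Polynomial.X + 1, fun a => by simp, fun F => ⟨[], .var 0, fun H a => ⟨1, by simp, ?_⟩⟩⟩
  exact .var _ _ _ rfl

theorem comp {g : β → γ} {f : α → β} (hg : PTime g) (hf : PTime f) :
    PTime (fun a => g (f a)) := by
  obtain ⟨p, hp, hF⟩ := hf
  obtain ⟨q, hq, hG⟩ := hg
  refine ⟨p + q.comp p + 1, fun a => ?_, fun F => ?_⟩
  · have := (hq (f a)).trans (q.eval_le_eval_of_le (hp a))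
    simp only [Polynomial.eval_add, Polynomial.eval_comp, Polynomial.eval_one]
    omega
  · obtain ⟨G₁, e₁, h₁⟩ := hF F
    -- Calls refer to absolute positions; asking for this code with `F ++ G₁` in front keeps them
    -- correct after concatenation.
    obtain ⟨G₂, e₂, h₂⟩ := hG (F ++ G₁)
    refine ⟨G₁ ++ G₂, .letIn e₁ e₂, fun H a => ?_⟩
    obtain ⟨s₁, hs₁, E₁⟩ := h₁ (G₂ ++ H) a
    obtain ⟨s₂, hs₂, E₂⟩ := h₂ H (f a)
    simp only [List.append_assoc] at E₁ E₂ ⊢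
    refine ⟨s₁ + s₂ + 1, ?_, .letIn _ _ _ _ _ _ _ E₁ (E₂.append_env [enc a])⟩
    have := hs₂.trans (q.eval_le_eval_of_le (hp a))
    simp only [Polynomial.eval_add, Polynomial.eval_comp, Polynomial.eval_one]
    omega

theorem pair {f : α → β} {g : α → γ} (hf : PTime f) (hg : PTime g) :
    PTime (fun a => (f a, g a)) := by
  obtain ⟨p, hp, hF⟩ := hf
  obtain ⟨q, hq, hG⟩ := hg
  refine ⟨p + q + 1, fun a => ?_, fun F => ?_⟩
  · have := hp a
    have := hq a
    simp only [Polynomial.eval_add, Polynomial.eval_one, esize_pair]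
    omega
  · obtain ⟨G₁, e₁, h₁⟩ := hF F
    obtain ⟨G₂, e₂, h₂⟩ := hG (F ++ G₁)
    refine ⟨G₁ ++ G₂, .cons e₁ e₂, fun H a => ?_⟩
    obtain ⟨s₁, hs₁, E₁⟩ := h₁ (G₂ ++ H) a
    obtain ⟨s₂, hs₂, E₂⟩ := h₂ H a
    simp only [List.append_assoc] at E₁ E₂ ⊢
    refine ⟨s₁ + s₂ + 1, ?_, .cons _ _ _ _ _ _ _ E₁ E₂⟩
    simp only [Polynomial.eval_add, Polynomial.eval_one]
    omega

protected theorem fst : PTime (fun x : α × β => x.1) := by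
  refine ⟨Polynomial.X + 3, fun a => ?_, fun F => ⟨[], .cases (.var 0) .nil (.var 0),
    fun H a => ⟨3, by simp, ?_⟩⟩⟩
  · simp [esize_pair]; omega
  · exact .casesCons _ _ _ _ _ (enc a.2) _ 1 1 (.var _ _ _ rfl) (.var _ _ _ rfl)

protected theorem snd : PTime (fun x : α × β => x.2) := by
  refine ⟨Polynomial.X + 3, fun a => ?_, fun F => ⟨[], .cases (.var 0) .nil (.var 1),
    fun H a => ⟨3, by simp, ?_⟩⟩⟩
  · simp [esize_pair]; omega
  · exact .casesCons _ _ _ _ (enc a.1) _ _ 1 1 (.var _ _ _ rfl) (.var _ _ _ rfl)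

/-- The expression that builds the tree `d`. -/
def _root_.Data.toExpr : Data → Expr
  | .nil => .nil
  | .cons a b => .cons a.toExpr b.toExpr

theorem _root_.Data.eval_toExpr (F : List Expr) (env : List Data) (d : Data) :
    Eval F env d.toExpr d d.size := by
  induction d with
  | nil => exact .nil _
  | cons a b iha ihb => exact .cons _ _ _ _ _ _ _ iha ihb

theorem const (b : β) : PTime (fun _ : α => b) := by
  refine ⟨Polynomial.C (esize b), fun a => by simp, fun F => ⟨[], (enc b).toExpr, fun H a => ?_⟩⟩
  exact ⟨esize b, by simp, Data.eval_toExpr _ _ _⟩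

/-- Case distinction on the shape of a value. -/
theorem case {τ : Type} [DataEnc τ] {t : α → τ} {f : α → β} {g : γ × δ × α → β} {r : α → β}
    (ht : PTime t) (hf : PTime f) (hg : PTime g)
    (hr : ∀ a, (enc (t a) = .nil ∧ r a = f a) ∨
      ∃ u v, enc (t a) = .cons (enc u) (enc v) ∧ r a = g (u, v, a)) :
    PTime r := by
  obtain ⟨p₁, hp₁, hF₁⟩ := ht
  obtain ⟨p₂, hp₂, hF₂⟩ := hf
  obtain ⟨p₃, hp₃, hF₃⟩ := hg
  have key : ∀ a u v, enc (t a) = .cons (enc u) (enc v) →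
      p₃.eval (esize ((u, v, a) : γ × δ × α)) ≤ p₃.eval (p₁.eval (esize a) + esize a + 1) := by
    intro a u v huv
    refine p₃.eval_le_eval_of_le ?_
    have := hp₁ a
    rw [esize, huv] at this
    simp only [esize_pair, Data.size] at this ⊢
    simp only [esize] at this ⊢
    omega
  refine ⟨p₁ + p₂ + p₃.comp (p₁ + Polynomial.X + 1) + 10, fun a => ?_, fun F => ?_⟩
  · simp only [Polynomial.eval_add, Polynomial.eval_comp, Polynomial.eval_one, Polynomial.eval_X,
      Polynomial.eval_ofNat]
    rcases hr a with ⟨-, h⟩ | ⟨u, v, huv, h⟩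
    · have := hp₂ a
      rw [h]; omega
    · have := hp₃ (u, v, a)
      have := key a u v huv
      rw [h]; omega
  · obtain ⟨G₁, e₁, h₁⟩ := hF₁ F
    obtain ⟨G₂, e₂, h₂⟩ := hF₂ (F ++ G₁)
    obtain ⟨G₃, e₃, h₃⟩ := hF₃ (F ++ G₁ ++ G₂)
    refine ⟨G₁ ++ G₂ ++ G₃, .cases e₁ e₂
      (.letIn (.cons (.var 0) (.cons (.var 1) (.var 2))) e₃), fun H a => ?_⟩
    obtain ⟨s₁, hs₁, E₁⟩ := h₁ (G₂ ++ G₃ ++ H) a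
    obtain ⟨s₂, hs₂, E₂⟩ := h₂ (G₃ ++ H) a
    simp only [List.append_assoc] at E₁ E₂ ⊢
    simp only [Polynomial.eval_add, Polynomial.eval_comp, Polynomial.eval_one, Polynomial.eval_X,
      Polynomial.eval_ofNat]
    rcases hr a with ⟨h0, h⟩ | ⟨u, v, huv, h⟩
    · rw [h0] at E₁
      rw [h]
      exact ⟨s₁ + s₂ + 1, by omega, .casesNil _ _ _ _ _ _ _ E₁ E₂⟩
    · rw [huv] at E₁
      obtain ⟨s₃, hs₃, E₃⟩ := h₃ H (u, v, a)
      have := key a u v huv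
      rw [h]
      simp only [List.append_assoc] at E₃
      refine ⟨s₁ + (5 + s₃ + 1) + 1, by omega, .casesCons _ _ _ _ _ _ _ _ _ E₁
        (.letIn _ _ _ _ _ _ _ (.cons _ _ _ _ _ 1 3 (.var _ _ _ rfl)
          (.cons _ _ _ _ _ 1 1 (.var _ _ _ rfl) (.var _ _ _ rfl))) ?_)⟩
      exact E₃.append_env _

/-- Recursion along the spine of a value, with a changing parameter. -/
theorem spineRec {L : Type} [DataEnc L] {f : γ → L → β} {g : γ → β} {d : γ × α × L → γ}
    {h : γ × α × L × β → β} (hg : PTime g) (hd : PTime d) (hh : PTime h)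
    (hsize : ∃ p : Polynomial ℕ, ∀ c x, esize (f c x) ≤ p.eval (esize (c, x)))
    (hdec : ∀ c a l, esize (d (c, a, l)) ≤ esize c + esize a + 1)
    (hr : ∀ x, (enc x = .nil ∧ ∀ c, f c x = g c) ∨ ∃ a l, enc x = .cons (enc a) (enc l) ∧
      ∀ c, f c x = h (c, a, l, f (d (c, a, l)) l)) :
    PTime (fun x : γ × L => f x.1 x.2) := by
  obtain ⟨p₀, hp₀⟩ := hsize
  obtain ⟨p₁, hp₁, hF₁⟩ := hg
  obtain ⟨p₂, hp₂, hF₂⟩ := hd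
  obtain ⟨p₃, hp₃, hF₃⟩ := hh
  let Q : Polynomial ℕ := p₁ + p₂.comp (Polynomial.X + 1) +
    p₃.comp (Polynomial.X + 2 + p₀.comp (Polynomial.X + 1)) + 25
  refine ⟨p₀ + (Polynomial.X + 10) * Q + 10, fun x => ?_, fun F => ?_⟩
  · have := hp₀ x.1 x.2
    simp only [Polynomial.eval_add]
    exact this.trans (by rw [Prod.mk.eta]; omega)
  obtain ⟨G₁, e₁, h₁⟩ := hF₁ F
  obtain ⟨G₂, e₂, h₂⟩ := hF₂ (F ++ G₁)
  obtain ⟨G₃, e₃, h₃⟩ := hF₃ (F ++ G₁ ++ G₂)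
  let i := (F ++ G₁ ++ G₂ ++ G₃).length
  -- The two `cases` open the argument pair and then `x`, leaving the environment `a, l, c, x, …`.
  -- Each `letIn` puts its value at index 0, where `e₂` and `e₃` expect their argument.
  let body : Expr := .cases (.var 0) .nil (.cases (.var 1) e₁
    (.letIn (.cons (.var 2) (.cons (.var 0) (.var 1)))
      (.letIn e₂ (.letIn (.call i (.cons (.var 0) (.var 3)))
        (.letIn (.cons (.var 5) (.cons (.var 3) (.cons (.var 4) (.var 0)))) e₃)))))
  refine ⟨G₁ ++ G₂ ++ G₃ ++ [body], .call i (.var 0), fun H x => ?_⟩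
  set A := F ++ (G₁ ++ G₂ ++ G₃ ++ [body]) ++ H with hA
  have hi : A[i]? = some body := by
    have : A = (F ++ G₁ ++ G₂ ++ G₃) ++ (body :: H) := by simp [hA]
    rw [this, List.getElem?_append_right (le_refl _)]
    simp
  have E₁ : ∀ c, ∃ s ≤ p₁.eval (esize c), Eval A [enc c] e₁ (enc (g c)) s := fun c => by
    have := h₁ (G₂ ++ G₃ ++ [body] ++ H) c
    simpa [hA] using this
  have E₂ : ∀ c, ∃ s ≤ p₂.eval (esize c), Eval A [enc c] e₂ (enc (d c)) s := fun c => by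
    have := h₂ (G₃ ++ [body] ++ H) c
    simpa [hA] using this
  have E₃ : ∀ c, ∃ s ≤ p₃.eval (esize c), Eval A [enc c] e₃ (enc (h c)) s := fun c => by
    have := h₃ ([body] ++ H) c
    simpa [hA] using this
  -- `n` bounds the depth of the recursion, while `M` bounds all the parameters that occur: by
  -- `hdec`, whatever the parameter gains is at most what the remaining list loses. So each level
  -- costs at most `Q.eval M`.
  have main : ∀ M n : ℕ, ∀ c x, esize x ≤ n → esize c + esize x ≤ M →
      ∃ s ≤ n * Q.eval M, Eval A [enc (c, x)] body (enc (f c x)) s := by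
    intro M n
    induction n with
    | zero => intro c x hx; exact absurd (esize_pos x) (by omega)
    | succ n ih =>
      intro c x hx hM
      have hcM : esize c ≤ M := by omega
      have hQ : Q.eval M = p₁.eval M + p₂.eval (M + 1) +
          p₃.eval (M + 2 + p₀.eval (M + 1)) + 25 := by
        simp [Q]
      rcases hr x with ⟨h0, hf⟩ | ⟨a, l, h0, hf⟩
      · obtain ⟨s, hs, E⟩ := E₁ c
        have := hs.trans (p₁.eval_le_eval_of_le hcM)
        refine ⟨1 + (1 + s + 1) + 1, by rw [add_mul, one_mul, hQ]; omega, ?_⟩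
        refine .casesCons _ _ _ _ (enc c) (enc x) _ _ _ (.var _ _ _ rfl)
          (.casesNil _ _ _ _ _ _ _ (.var _ _ _ (by rw [h0]; rfl)) ?_)
        rw [hf c]
        exact E.append_env _
      · have hxl : esize x = esize a + esize l + 1 := by simp only [esize, h0, Data.size]
        have hd' := hdec c a l
        obtain ⟨s₂, hs₂, E2⟩ := E₂ (c, a, l)
        obtain ⟨s, hs, E⟩ := ih (d (c, a, l)) l (by omega) (by omega)
        obtain ⟨s₃, hs₃, E3⟩ := E₃ (c, a, l, f (d (c, a, l)) l)
        have hfs := hp₀ (d (c, a, l)) l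
        simp only [esize_pair] at hs₂ hs₃ hfs
        have hs₂' := hs₂.trans (p₂.eval_le_eval_of_le (n := M + 1) (by omega))
        have hfs' := hfs.trans (p₀.eval_le_eval_of_le (n := M + 1) (by omega))
        have hs₃' := hs₃.trans (p₃.eval_le_eval_of_le (n := M + 2 + p₀.eval (M + 1)) (by omega))
        refine ⟨1 + (1 + (5 + (s₂ + ((3 + s + 1) + (7 + s₃ + 1) + 1) + 1) + 1) + 1) + 1,
          by rw [add_mul, one_mul, hQ]; rw [hQ] at hs; omega, ?_⟩
        refine .casesCons _ _ _ _ (enc c) (enc x) _ _ _ (.var _ _ _ rfl)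
          (.casesCons _ _ _ _ (enc a) (enc l) _ _ _ (.var _ _ _ (by rw [h0]; rfl)) ?_)
        refine .letIn _ _ _ (enc (c, a, l)) _ _ _ (.cons _ _ _ _ _ 1 3 (.var _ _ _ rfl)
          (.cons _ _ _ _ _ 1 1 (.var _ _ _ rfl) (.var _ _ _ rfl))) ?_
        refine .letIn _ _ _ (enc (d (c, a, l))) _ _ _ (E2.append_env _) ?_
        refine .letIn _ _ _ (enc (f (d (c, a, l)) l)) _ _ _ (.call _ _ _ _ _ _ _ _ hi
          (.cons _ _ _ (enc (d (c, a, l))) (enc l) 1 1 (.var _ _ _ rfl) (.var _ _ _ rfl)) E) ?_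
        refine .letIn _ _ _ (enc (c, a, l, f (d (c, a, l)) l)) _ _ _
          (.cons _ _ _ _ _ 1 5 (.var _ _ _ rfl) (.cons _ _ _ _ _ 1 3 (.var _ _ _ rfl)
            (.cons _ _ _ _ _ 1 1 (.var _ _ _ rfl) (.var _ _ _ rfl)))) ?_
        rw [hf c]
        exact E3.append_env _
  obtain ⟨s, hs, E⟩ := main (esize x) (esize x) x.1 x.2 (by rw [esize_pair]; omega)
    (by rw [esize_pair]; omega)
  refine ⟨1 + s + 1, ?_, .call _ _ _ _ _ _ _ _ hi (.var _ _ _ rfl) E⟩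
  simp only [Polynomial.eval_add, Polynomial.eval_mul, Polynomial.eval_X, Polynomial.eval_ofNat]
  have : esize x * Q.eval (esize x) ≤ (esize x + 10) * Q.eval (esize x) :=
    Nat.mul_le_mul_right _ (by omega)
  omega

/-- Equality of values is decidable in polynomial time. -/
theorem decide_eq [DecidableEq β] {f g : α → β} (hf : PTime f) (hg : PTime g) :
    PTime (fun a => decide (f a = g a)) := by
  classical
  -- Encodings are injective, so it suffices to compare trees.
  suffices h : PTime (fun x : Data × Data => decide (x.1 = x.2)) by
    have h' : PTime (fun x : β × β => decide (x.1 = x.2)) := by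
      refine h.congr_enc (fun x : β × β => (enc x.1, enc x.2)) (fun x => rfl) fun x => ?_
      simp [DataEnc.inj.eq_iff]
    exact h'.comp (hf.pair hg)
  refine ⟨20 * Polynomial.X + 10, fun x => ?_, fun F => ?_⟩
  · have := esize_bool_le (decide (x.1 = x.2))
    simp only [Polynomial.eval_add, Polynomial.eval_mul, Polynomial.eval_X, Polynomial.eval_ofNat]
    omega
  let tt : Expr := .cons .nil .nil
  let body : Expr := .cases (.var 0) .nil (.cases (.var 0)
    (.cases (.var 1) tt .nil)
    (.cases (.var 3) .nil
      (.cases (.call F.length (.cons (.var 2) (.var 0))) .nil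
        (.call F.length (.cons (.var 5) (.var 3))))))
  refine ⟨[body], .call F.length (.var 0), fun H x => ?_⟩
  set A := F ++ [body] ++ H with hA
  have hi : A[F.length]? = some body := by simp [hA]
  -- The recursion enters each node of the first tree at most once, hence the linear bound, whatever
  -- the size of `b`.
  have main : ∀ a b : Data, ∃ s ≤ 20 * a.size,
      Eval A [.cons a b] body (encodeBool (decide (a = b))) s := by
    intro a
    induction a with
    | nil =>
      intro b
      cases b with
      | nil =>
        rw [decide_eq_true rfl]
        exact ⟨1 + (1 + (1 + 3 + 1) + 1) + 1, by simp [Data.size],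
          .casesCons _ _ _ _ .nil .nil _ _ _ (.var _ _ _ rfl)
          (.casesNil _ _ _ _ _ _ _ (.var _ _ _ rfl) (.casesNil _ _ _ _ _ _ _ (.var _ _ _ rfl)
            (.cons _ _ _ _ _ _ _ (.nil _) (.nil _))))⟩
      | cons b₁ b₂ =>
        rw [decide_eq_false (by simp)]
        exact ⟨1 + (1 + (1 + 1 + 1) + 1) + 1, by simp [Data.size],
          .casesCons _ _ _ _ .nil (.cons b₁ b₂) _ _ _ (.var _ _ _ rfl)
          (.casesNil _ _ _ _ _ _ _ (.var _ _ _ rfl) (.casesCons _ _ _ _ b₁ b₂ _ _ _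
            (.var _ _ _ rfl) (.nil _)))⟩
    | cons a₁ a₂ ih₁ ih₂ =>
      intro b
      cases b with
      | nil =>
        rw [decide_eq_false (by simp)]
        exact ⟨1 + (1 + (1 + 1 + 1) + 1) + 1, by simp only [Data.size]; omega,
          .casesCons _ _ _ _ (.cons a₁ a₂) .nil _ _ _
          (.var _ _ _ rfl) (.casesCons _ _ _ _ a₁ a₂ _ _ _ (.var _ _ _ rfl)
            (.casesNil _ _ _ _ _ _ _ (.var _ _ _ rfl) (.nil _)))⟩
      | cons b₁ b₂ =>
        obtain ⟨s₁, hs₁, E₁⟩ := ih₁ b₁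
        obtain ⟨s₂, hs₂, E₂⟩ := ih₂ b₂
        have C₁ : Eval A [b₁, b₂, a₁, a₂, .cons a₁ a₂, .cons b₁ b₂, .cons (.cons a₁ a₂)
            (.cons b₁ b₂)] (.call F.length (.cons (.var 2) (.var 0)))
            (encodeBool (decide (a₁ = b₁))) (3 + s₁ + 1) :=
          .call _ _ _ _ _ _ _ _ hi
            (.cons _ _ _ _ _ 1 1 (.var _ _ _ rfl) (.var _ _ _ rfl)) E₁
        by_cases h : a₁ = b₁
        · have e : decide (Data.cons a₁ a₂ = Data.cons b₁ b₂) = decide (a₂ = b₂) := by simp [h]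
          rw [decide_eq_true h] at C₁
          rw [e]
          refine ⟨1 + (1 + (1 + ((3 + s₁ + 1) + (3 + s₂ + 1) + 1) + 1) + 1) + 1,
            by simp only [Data.size]; omega, ?_⟩
          exact .casesCons _ _ _ _ (.cons a₁ a₂) (.cons b₁ b₂) _ _ _
            (.var _ _ _ rfl) (.casesCons _ _ _ _ a₁ a₂ _ _ _ (.var _ _ _ rfl)
            (.casesCons _ _ _ _ b₁ b₂ _ _ _ (.var _ _ _ rfl)
            (.casesCons _ _ _ _ .nil .nil _ _ _ C₁ (.call _ _ _ _ _ _ _ _ hi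
              (.cons _ _ _ _ _ 1 1 (.var _ _ _ rfl) (.var _ _ _ rfl)) E₂))))
        · rw [decide_eq_false h] at C₁
          rw [decide_eq_false (by simp [h])]
          refine ⟨1 + (1 + (1 + ((3 + s₁ + 1) + 1 + 1) + 1) + 1) + 1,
            by simp only [Data.size]; omega, ?_⟩
          exact .casesCons _ _ _ _ (.cons a₁ a₂) (.cons b₁ b₂) _ _ _
            (.var _ _ _ rfl) (.casesCons _ _ _ _ a₁ a₂ _ _ _ (.var _ _ _ rfl)
            (.casesCons _ _ _ _ b₁ b₂ _ _ _ (.var _ _ _ rfl)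
            (.casesNil _ _ _ _ _ (3 + s₁ + 1) 1 C₁ (.nil _))))
  obtain ⟨s, hs, E⟩ := main x.1 x.2
  refine ⟨1 + s + 1, ?_, .call _ _ _ _ _ _ _ _ hi (.var _ _ _ rfl) E⟩
  have : x.1.size ≤ esize x := by rw [esize_pair]; simp only [esize, enc, id]; omega
  simp only [Polynomial.eval_add, Polynomial.eval_mul, Polynomial.eval_X, Polynomial.eval_ofNat]
  omega

/-- A function computed in polynomial time is computed by a program. -/
theorem exists_program {f : α → β} (hf : PTime f) :
    ∃ (P : Program) (p : Polynomial ℕ), ∀ a, ∃ s ≤ p.eval (esize a),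
      P.Runs (enc a) (enc (f a)) s := by
  obtain ⟨p, -, hF⟩ := hf
  obtain ⟨G, e, h⟩ := hF []
  refine ⟨⟨G, e⟩, p, fun a => ?_⟩
  simpa [Program.Runs] using h [] a

end PTime

/-! ### Size estimates for lists and binary numbers -/

section Size
variable {α β : Type} [DataEnc α] [DataEnc β]

theorem esize_le_of_mem {a : α} {l : List α} (h : a ∈ l) : esize a ≤ esize l := by
  induction l with
  | nil => simp at h
  | cons b l ih =>
    rw [esize_cons]
    rcases List.mem_cons.1 h with rfl | h
    · omega
    · have := ih h
      omega

theorem esize_map_le {g : α → β} {l : List α} {B : ℕ} (h : ∀ a ∈ l, esize (g a) ≤ B) :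
    esize (l.map g) ≤ 1 + esize l * (B + 1) := by
  induction l with
  | nil => simp [esize_nil]
  | cons a l ih =>
    have h1 := ih fun b hb => h b (List.mem_cons_of_mem _ hb)
    have h2 := h a List.mem_cons_self
    rw [List.map_cons, esize_cons, esize_cons, add_mul, add_mul]
    have := Nat.mul_le_mul_right (B + 1) (esize_pos a)
    omega

theorem esize_append (l l' : List α) : esize (l ++ l') + 1 = esize l + esize l' := by
  induction l with
  | nil => simp [esize_nil]; omega
  | cons a l ih => rw [List.cons_append, esize_cons, esize_cons]; omega

theorem esize_flatten_le (L : List (List α)) : esize L.flatten ≤ esize L := by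
  induction L with
  | nil => simp [esize_nil]
  | cons l L ih =>
    have := esize_append l L.flatten
    rw [List.flatten_cons, esize_cons]
    omega

theorem esize_le_of_sublist {l l' : List α} (h : l.Sublist l') : esize l ≤ esize l' := by
  induction h with
  | slnil => exact le_rfl
  | cons a _ ih => rw [esize_cons]; omega
  | cons_cons a _ ih => rw [esize_cons, esize_cons]; omega

/-- Presents a nonzero number as a list with its parity as head and its half as tail, so that
`PTime.case` and `PTime.spineRec` apply to numbers. -/
theorem enc_nat_of_ne_zero {n : ℕ} (h : n ≠ 0) :
    enc n = .cons (enc (decide (n % 2 = 1))) (enc (n / 2)) := by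
  change encodeList _ _ = _
  rcases Nat.even_or_odd' n with ⟨m, rfl | rfl⟩
  · rw [Nat.bit0_bits m (by omega)]
    simp [encodeList, enc, encodeNat]
  · rw [Nat.bit1_bits m]
    have : (2 * m + 1) / 2 = m := by omega
    rw [this]
    simp [encodeList, enc, encodeNat]

/-- A digit costs two nodes or four, including its list cell, and the end of the list costs one. -/
theorem esize_nat_bounds (n : ℕ) : n.size ≤ esize n ∧ esize n ≤ 4 * n.size + 1 := by
  rw [← Nat.size_eq_bits_len]
  change _ ≤ (encodeList _ _).size ∧ (encodeList _ _).size ≤ _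
  induction n.bits with
  | nil => simp [encodeList, Data.size]
  | cons b l ih => cases b <;> simp [encodeList, encodeBool, Data.size] <;> omega

theorem Nat.size_add_le (m n : ℕ) : (m + n).size ≤ m.size + n.size := by
  rcases m.eq_zero_or_pos with rfl | hm
  · simp
  rcases n.eq_zero_or_pos with rfl | hn
  · simp
  rw [Nat.size_le]
  have h1 := Nat.lt_size_self m
  have h2 := Nat.lt_size_self n
  rw [pow_add]
  have h3 := Nat.mul_le_mul (show m + 1 ≤ _ from h1) (show n + 1 ≤ _ from h2)
  nlinarith

theorem Nat.size_mul_le (m n : ℕ) : (m * n).size ≤ m.size + n.size := by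
  rw [Nat.size_le, pow_add]
  exact Nat.mul_lt_mul'' (Nat.lt_size_self m) (Nat.lt_size_self n)

theorem esize_nat_le_of_le {m n : ℕ} (h : m ≤ n) : esize m ≤ 4 * esize n + 1 := by
  have := (esize_nat_bounds m).2
  have := (esize_nat_bounds n).1
  have := Nat.size_le_size h
  omega

end Size

namespace PTime

variable {α β γ δ : Type} [DataEnc α] [DataEnc β] [DataEnc γ] [DataEnc δ]

/-! #### Booleans -/

theorem ite {c : α → Bool} {f g : α → β} (hc : PTime c) (hf : PTime f) (hg : PTime g) :
    PTime (fun a => if c a = true then f a else g a) := by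
  refine case (γ := Unit) (δ := Unit) (g := fun x => f x.2.2) hc hg
    (hf.comp (PTime.snd.comp PTime.snd)) fun a => ?_
  cases h : c a
  · exact .inl ⟨rfl, by simp⟩
  · exact .inr ⟨(), (), rfl, by simp⟩

theorem ite_prop {c : α → Prop} {_ : DecidablePred c} {f g : α → β} (hc : PTime fun a => decide (c a))
    (hf : PTime f) (hg : PTime g) : PTime (fun a => if c a then f a else g a) := by
  simpa using ite hc hf hg

theorem and {b c : α → Bool} (hb : PTime b) (hc : PTime c) : PTime (fun a => b a && c a) := by
  convert ite hb hc (const false) using 2 with a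
  cases b a <;> simp

theorem or {b c : α → Bool} (hb : PTime b) (hc : PTime c) : PTime (fun a => b a || c a) := by
  convert ite hb (const true) hc using 2 with a
  cases b a <;> simp

theorem not {b : α → Bool} (hb : PTime b) : PTime (fun a => !b a) := by
  convert ite hb (const false) (const true) using 2 with a
  cases b a <;> simp

/-! #### Lists -/

theorem cons {f : γ → α} {l : γ → List α} (hf : PTime f) (hl : PTime l) :
    PTime (fun c => f c :: l c) :=
  (hf.pair hl).congr_enc (fun c => c) (fun _ => rfl) fun _ => rfl

/-- This is `spineRec` with a constant parameter. The bound on the values is a genuine hypothesis: a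
polynomial-time step may double the size at every iteration. -/
theorem foldr {l : γ → List α} {step : γ → α → β → β} {init : γ → β} (hl : PTime l)
    (hstep : PTime (fun x : γ × α × β => step x.1 x.2.1 x.2.2)) (hinit : PTime init)
    (hsize : ∃ p : Polynomial ℕ, ∀ c (l : List α),
      esize (l.foldr (step c) (init c)) ≤ p.eval (esize (c, l))) :
    PTime (fun c => (l c).foldr (step c) (init c)) := by
  have : PTime (fun x : γ × List α => x.2.foldr (step x.1) (init x.1)) := by
    refine spineRec (f := fun c (l : List α) => l.foldr (step c) (init c)) (g := init)
      (d := fun x : γ × α × List α => x.1)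
      (h := fun x : γ × α × List α × β => step x.1 x.2.1 x.2.2.2) hinit PTime.fst
      (hstep.comp (PTime.fst.pair ((PTime.fst.comp PTime.snd).pair
        (PTime.snd.comp (PTime.snd.comp PTime.snd))))) hsize (fun c a l => ?_) fun x => ?_
    · dsimp only; omega
    · cases x with
      | nil => exact .inl ⟨rfl, fun c => rfl⟩
      | cons a l => exact .inr ⟨a, l, rfl, fun c => rfl⟩
  exact this.comp (PTime.id.pair hl)

theorem map {l : γ → List α} {g : γ → α → β} (hl : PTime l)
    (hg : PTime (fun x : γ × α => g x.1 x.2)) : PTime (fun c => (l c).map (g c)) := by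
  obtain ⟨q, hq⟩ := hg.size_le
  have : ∀ c (l : List α), l.map (g c) = l.foldr (fun a r => g c a :: r) [] := fun c l => by
    induction l with
    | nil => rfl
    | cons a l ih => rw [List.map_cons, List.foldr_cons, ih]
  simp only [this]
  refine foldr hl (step := fun c a r => g c a :: r) (init := fun _ => [])
    ((hg.comp (PTime.fst.pair (PTime.fst.comp PTime.snd))).cons (PTime.snd.comp PTime.snd))
    (const _) ⟨1 + Polynomial.X * (q + 1), fun c l => ?_⟩
  rw [← this]
  refine (esize_map_le (B := q.eval (esize (c, l))) fun a ha => ?_).trans ?_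
  · refine (hq (c, a)).trans (q.eval_le_eval_of_le ?_)
    have := esize_le_of_mem ha
    simp only [esize_pair]
    omega
  · simp only [Polynomial.eval_add, Polynomial.eval_mul, Polynomial.eval_X, Polynomial.eval_one]
    have : esize l ≤ esize (c, l) := by simp only [esize_pair]; omega
    exact Nat.add_le_add_left (Nat.mul_le_mul_right _ this) _

theorem append {l l' : γ → List α} (hl : PTime l) (hl' : PTime l') :
    PTime (fun c => l c ++ l' c) := by
  have h : PTime (fun x : List α × List α => x.1 ++ x.2) := by
    have : ∀ x : List α × List α, x.1 ++ x.2 = x.1.foldr List.cons x.2 := fun x => by simp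
    simp only [this]
    refine foldr (l := fun x : List α × List α => x.1) (step := fun _ a r => a :: r)
      (init := fun x => x.2) PTime.fst
      ((PTime.fst.comp PTime.snd).cons (PTime.snd.comp PTime.snd)) PTime.snd
      ⟨Polynomial.X, fun c l => ?_⟩
    have := esize_append l c.2
    have h : l.foldr (fun a r => a :: r) c.2 = l ++ c.2 := by simp
    simp only [h, esize_pair, Polynomial.eval_X]
    omega
  exact h.comp (hl.pair hl')

theorem flatten {L : γ → List (List α)} (hL : PTime L) : PTime (fun c => (L c).flatten) := by
  have : ∀ L : List (List α), L.flatten = L.foldr (fun l r => l ++ r) [] := fun L => by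
    induction L with
    | nil => rfl
    | cons l L ih => simp [ih]
  simp only [this]
  refine foldr (step := fun _ l r => l ++ r) (init := fun _ => []) hL
    (append (PTime.fst.comp PTime.snd) (PTime.snd.comp PTime.snd)) (const _)
    ⟨Polynomial.X, fun c l => ?_⟩
  have h := esize_flatten_le l
  rw [← this, Polynomial.eval_X, esize_pair]
  dsimp only
  omega

theorem flatMap {l : γ → List α} {g : γ → α → List β} (hl : PTime l)
    (hg : PTime (fun x : γ × α => g x.1 x.2)) : PTime (fun c => (l c).flatMap (g c)) :=
  flatten (map hl hg)

theorem filter {l : γ → List α} {g : γ → α → Bool} (hl : PTime l)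
    (hg : PTime (fun x : γ × α => g x.1 x.2)) : PTime (fun c => (l c).filter (g c)) := by
  have : ∀ c (l : List α), l.filter (g c) =
      l.foldr (fun a r => if g c a = true then a :: r else r) [] := fun c l => by
    induction l with
    | nil => rfl
    | cons a l ih => simp [List.filter_cons, ih]
  simp only [this]
  refine foldr (step := fun c a r => if g c a = true then a :: r else r) (init := fun _ => []) hl
    (ite (hg.comp (PTime.fst.pair (PTime.fst.comp PTime.snd)))
      ((PTime.fst.comp PTime.snd).cons (PTime.snd.comp PTime.snd)) (PTime.snd.comp PTime.snd))
    (const _) ⟨Polynomial.X, fun c l => ?_⟩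
  rw [← this, Polynomial.eval_X, esize_pair]
  dsimp only
  have := esize_le_of_sublist (List.filter_sublist (p := g c) (l := l))
  omega

theorem any {l : γ → List α} {g : γ → α → Bool} (hl : PTime l)
    (hg : PTime (fun x : γ × α => g x.1 x.2)) : PTime (fun c => (l c).any (g c)) := by
  have : ∀ c (l : List α), l.any (g c) = l.foldr (fun a r => g c a || r) false := fun c l => by
    induction l with
    | nil => rfl
    | cons a l ih => simp [ih]
  simp only [this]
  exact foldr (step := fun c a r => g c a || r) (init := fun _ => false) hl
    (or (hg.comp (PTime.fst.pair (PTime.fst.comp PTime.snd))) (PTime.snd.comp PTime.snd))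
    (const _) ⟨3, fun c l => by simpa using esize_bool_le _⟩

theorem all {l : γ → List α} {g : γ → α → Bool} (hl : PTime l)
    (hg : PTime (fun x : γ × α => g x.1 x.2)) : PTime (fun c => (l c).all (g c)) := by
  simp only [List.all_eq_not_any_not]
  exact not (any hl (g := fun c a => !g c a) (not hg))

theorem decide_mem [DecidableEq α] {f : γ → α} {l : γ → List α} (hf : PTime f) (hl : PTime l) :
    PTime (fun c => decide (f c ∈ l c)) := by
  have : ∀ c, decide (f c ∈ l c) = (l c).any fun a => decide (f c = a) := fun c => by
    rw [Bool.eq_iff_iff]; simp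
  simp only [this]
  exact any hl (g := fun c a => decide (f c = a)) (decide_eq (hf.comp PTime.fst) PTime.snd)

theorem dedup [DecidableEq α] {l : γ → List α} (hl : PTime l) : PTime (fun c => (l c).dedup) := by
  have : ∀ l : List α, l.dedup = l.foldr (fun a r => if a ∈ r then r else a :: r) [] := fun l => by
    induction l with
    | nil => rfl
    | cons a l ih =>
      rw [List.foldr_cons, ← ih]
      by_cases h : a ∈ l
      · rw [List.dedup_cons_of_mem h, if_pos (List.mem_dedup.2 h)]
      · rw [List.dedup_cons_of_notMem h, if_neg (mt List.mem_dedup.1 h)]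
  simp only [this]
  refine foldr (step := fun _ a r => if a ∈ r then r else a :: r) (init := fun _ => []) hl
    (ite_prop (decide_mem (PTime.fst.comp PTime.snd) (PTime.snd.comp PTime.snd))
      (PTime.snd.comp PTime.snd) ((PTime.fst.comp PTime.snd).cons (PTime.snd.comp PTime.snd)))
    (const _) ⟨Polynomial.X, fun c l => ?_⟩
  rw [← this, Polynomial.eval_X, esize_pair]
  dsimp only
  have := esize_le_of_sublist (List.dedup_sublist l)
  omega

theorem tail {l : γ → List α} (hl : PTime l) : PTime (fun c => (l c).tail) := by
  refine case (γ := α) (δ := List α) (f := fun _ => []) (g := fun x => x.2.1) hl (const _)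
    (PTime.fst.comp PTime.snd) fun c => ?_
  cases l c with
  | nil => exact .inl ⟨rfl, rfl⟩
  | cons a l => exact .inr ⟨a, l, rfl, rfl⟩

theorem take_one {l : γ → List α} (hl : PTime l) : PTime (fun c => (l c).take 1) := by
  refine case (γ := α) (δ := List α) (f := fun _ => []) (g := fun x => [x.1]) hl (const _)
    (PTime.fst.cons (const _)) fun c => ?_
  cases l c with
  | nil => exact .inl ⟨rfl, rfl⟩
  | cons a l => exact .inr ⟨a, l, rfl, by simp⟩

theorem getD {l : γ → List α} (hl : PTime l) (i : ℕ) (d : α) :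
    PTime (fun c => (l c).getD i d) := by
  induction i generalizing l with
  | zero =>
    refine case (γ := α) (δ := List α) (f := fun _ => d) (g := fun x => x.1) hl (const _)
      PTime.fst fun c => ?_
    cases l c with
    | nil => exact .inl ⟨rfl, rfl⟩
    | cons a l => exact .inr ⟨a, l, rfl, rfl⟩
  | succ i ih =>
    convert ih hl.tail using 2 with c
    cases l c <;> simp

theorem ofFn {n : ℕ} {f : γ → Fin n → α} (hf : ∀ i, PTime (fun c => f c i)) :
    PTime (fun c => List.ofFn (f c)) := by
  induction n with
  | zero => simpa using const _
  | succ n ih =>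
    simp only [List.ofFn_succ]
    exact (hf 0).cons (ih fun i => hf i.succ)

/-- Conjunction over a fixed list. -/
theorem all_const {τ : Type} (l : List τ) {g : γ → τ → Bool} (hg : ∀ t ∈ l, PTime (fun c => g c t)) :
    PTime (fun c => l.all (g c)) := by
  induction l with
  | nil => simpa using const true
  | cons t l ih =>
    simp only [List.all_cons]
    exact (hg t List.mem_cons_self).and (ih fun u hu => hg u (List.mem_cons_of_mem _ hu))

theorem map_const {τ : Type} (l : List τ) {g : γ → τ → α} (hg : ∀ t, PTime (fun c => g c t)) :
    PTime (fun c => l.map (g c)) := by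
  induction l with
  | nil => simpa using const _
  | cons t l ih => exact (hg t).cons ih

/-! #### Numbers -/

theorem bits {n : γ → ℕ} (hn : PTime n) : PTime (fun c => (n c).bits) :=
  hn.congr_enc (fun c => c) (fun _ => rfl) fun _ => rfl

theorem ofBit {n : γ → ℕ} {b : γ → Bool} (hn : PTime n) (hb : PTime b) :
    PTime (fun c => 2 * n c + (b c).toNat) := by
  have : PTime (fun c => (2 * n c + (b c).toNat).bits) := by
    -- Zero is special: adding the digit `false` must give the empty list again, since
    -- representations have no leading zeros.
    refine case (γ := Bool) (δ := ℕ) (f := fun c => if b c = true then [true] else [])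
      (g := fun x => b x.2.2 :: (n x.2.2).bits) hn (ite hb (const _) (const _))
      ((hb.comp (PTime.snd.comp PTime.snd)).cons (bits (hn.comp (PTime.snd.comp PTime.snd))))
      fun c => ?_
    by_cases h : n c = 0
    · refine .inl ⟨by rw [h]; rfl, ?_⟩
      cases b c <;> simp [h]
    · refine .inr ⟨_, _, enc_nat_of_ne_zero h, ?_⟩
      cases b c
      · simp [Nat.bit0_bits _ h]
      · simp [Nat.bit1_bits]
  exact this.congr_enc (fun c => c) (fun _ => rfl) fun _ => rfl

theorem half {n : γ → ℕ} (hn : PTime n) : PTime (fun c => n c / 2) := by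
  refine case (γ := Bool) (δ := ℕ) (f := fun _ => 0) (g := fun x => x.2.1) hn (const _)
    (PTime.fst.comp PTime.snd) fun c => ?_
  by_cases h : n c = 0
  · exact .inl ⟨by rw [h]; rfl, by simp [h]⟩
  · exact .inr ⟨_, _, enc_nat_of_ne_zero h, rfl⟩

theorem odd {n : γ → ℕ} (hn : PTime n) : PTime (fun c => decide (n c % 2 = 1)) := by
  refine case (γ := Bool) (δ := ℕ) (f := fun _ => false) (g := fun x => x.1) hn (const _)
    PTime.fst fun c => ?_
  by_cases h : n c = 0
  · exact .inl ⟨by rw [h]; rfl, by simp [h]⟩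
  · exact .inr ⟨_, _, enc_nat_of_ne_zero h, rfl⟩

/-- Recursion on the binary digits, the least significant digit being removed first. -/
theorem natRec {f : γ → ℕ → β} {g : γ → β} {d : γ × Bool × ℕ → γ} {h : γ × Bool × ℕ × β → β}
    (hg : PTime g) (hd : PTime d) (hh : PTime h)
    (hsize : ∃ p : Polynomial ℕ, ∀ c n, esize (f c n) ≤ p.eval (esize (c, n)))
    (hdec : ∀ c a l, esize (d (c, a, l)) ≤ esize c + esize a + 1)
    (h0 : ∀ c, f c 0 = g c)
    (h1 : ∀ c n, n ≠ 0 → f c n =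
      h (c, decide (n % 2 = 1), n / 2, f (d (c, decide (n % 2 = 1), n / 2)) (n / 2))) :
    PTime (fun x : γ × ℕ => f x.1 x.2) := by
  refine spineRec hg hd hh hsize hdec fun n => ?_
  by_cases hn : n = 0
  · exact .inl ⟨by rw [hn]; rfl, fun c => by rw [hn, h0]⟩
  · exact .inr ⟨_, _, enc_nat_of_ne_zero hn, fun c => h1 c n hn⟩

theorem boolToNat {b : γ → Bool} (hb : PTime b) : PTime (fun c => (b c).toNat) := by
  simpa using ofBit (const 0) hb

theorem succ {n : γ → ℕ} (hn : PTime n) : PTime (fun c => n c + 1) := by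
  have : PTime (fun x : Unit × ℕ => x.2 + 1) := by
    refine natRec (f := fun _ n => n + 1) (g := fun _ => 1) (d := fun x => x.1)
      (h := fun x => if x.2.1 = true then 2 * x.2.2.2 + false.toNat else 2 * x.2.2.1 + true.toNat)
      (const _) PTime.fst (ite (PTime.fst.comp PTime.snd)
        (ofBit (PTime.snd.comp (PTime.snd.comp PTime.snd)) (const _))
        (ofBit (PTime.fst.comp (PTime.snd.comp PTime.snd)) (const _)))
      ⟨4 * Polynomial.X + 5, fun c n => ?_⟩ (fun c a l => by dsimp only; omega)
      (fun c => rfl) fun c n hn => ?_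
    · have h1 := (esize_nat_bounds (n + 1)).2
      have h2 := (esize_nat_bounds n).1
      have h3 := Nat.size_add_le n 1
      have h4 : Nat.size 1 = 1 := Nat.size_one
      simp only [esize_pair, Polynomial.eval_add, Polynomial.eval_mul, Polynomial.eval_X,
        Polynomial.eval_ofNat]
      omega
    · simp only [decide_eq_true_eq, Bool.toNat_false, Bool.toNat_true]
      split_ifs <;> omega
  exact this.comp ((const ()).pair hn)

theorem esize_half_le (n : ℕ) : esize (n / 2) ≤ esize n := by
  by_cases h : n = 0
  · simp [h]
  · rw [esize, esize, enc_nat_of_ne_zero h, Data.size]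
    omega

/-- Schoolbook addition. The parameter holds the other summand and the carry; the new carry is the
majority of the three bits, and the nested equality of Booleans is their exclusive or. -/
theorem add {m n : γ → ℕ} (hm : PTime m) (hn : PTime n) : PTime (fun c => m c + n c) := by
  have : PTime (fun x : (ℕ × Bool) × ℕ => x.2 + x.1.1 + x.1.2.toNat) := by
    refine natRec (f := fun c x => x + c.1 + c.2.toNat)
      (g := fun c => if c.2 = true then c.1 + 1 else c.1)
      (d := fun x => (x.1.1 / 2, (x.2.1 && decide (x.1.1 % 2 = 1)) ||
        (x.1.2 && (x.2.1 || decide (x.1.1 % 2 = 1)))))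
      (h := fun x => 2 * x.2.2.2 +
        (decide ((decide (x.2.1 = decide (x.1.1 % 2 = 1))) = x.1.2)).toNat)
      (ite PTime.snd (succ PTime.fst) PTime.fst) ?_ ?_ ?_ ?_ ?_ ?_
    · have y : PTime (fun x : (ℕ × Bool) × Bool × ℕ => x.1.1) := PTime.fst.comp PTime.fst
      have s : PTime (fun x : (ℕ × Bool) × Bool × ℕ => x.1.2) := PTime.snd.comp PTime.fst
      have b : PTime (fun x : (ℕ × Bool) × Bool × ℕ => x.2.1) := PTime.fst.comp PTime.snd
      exact (half y).pair (((b.and (odd y))).or (s.and (b.or (odd y))))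
    · have y : PTime (fun x : (ℕ × Bool) × Bool × ℕ × ℕ => x.1.1) := PTime.fst.comp PTime.fst
      have s : PTime (fun x : (ℕ × Bool) × Bool × ℕ × ℕ => x.1.2) := PTime.snd.comp PTime.fst
      have b : PTime (fun x : (ℕ × Bool) × Bool × ℕ × ℕ => x.2.1) := PTime.fst.comp PTime.snd
      exact ofBit (PTime.snd.comp (PTime.snd.comp PTime.snd)) (decide_eq (decide_eq b (odd y)) s)
    · refine ⟨4 * Polynomial.X + 10, fun c n => ?_⟩
      have h1 := (esize_nat_bounds (n + c.1 + c.2.toNat)).2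
      have h2 := (esize_nat_bounds n).1
      have h2' := (esize_nat_bounds c.1).1
      have h3 := Nat.size_add_le (n + c.1) c.2.toNat
      have h3' := Nat.size_add_le n c.1
      have h4 : Nat.size c.2.toNat ≤ 1 := by cases c.2 <;> simp
      simp only [esize_pair, Polynomial.eval_add, Polynomial.eval_mul, Polynomial.eval_X,
        Polynomial.eval_ofNat]
      omega
    · intro c a l
      have h1 := esize_half_le c.1
      have h2 := esize_pos c.2
      have h3 := esize_pos a
      -- The carry may grow from one node to three; the removed digit and its cell pay for this.
      refine le_trans (Nat.add_le_add_right (Nat.add_le_add h1 (esize_bool_le _)) 1) ?_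
      rw [esize_pair]
      omega
    · rintro ⟨y, s⟩
      cases s <;> simp
    · rintro ⟨y, s⟩ n hn
      rcases Nat.mod_two_eq_zero_or_one n with h | h <;>
      rcases Nat.mod_two_eq_zero_or_one y with h' | h' <;> cases s <;> simp [h, h'] <;> omega
  convert this.comp ((hm.pair (const false)).pair hn) using 2
  simp [add_comm]

/-- Generalized to `x + s ≤ y` with a borrow bit `s`: after halving both numbers, the new borrow
says whether the low bit of `x` plus `s` exceeds the low bit of `y`. -/
theorem decide_le {m n : γ → ℕ} (hm : PTime m) (hn : PTime n) :
    PTime (fun c => decide (m c ≤ n c)) := by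
  have : PTime (fun x : (ℕ × Bool) × ℕ => decide (x.2 + x.1.2.toNat ≤ x.1.1)) := by
    refine natRec (f := fun c x => decide (x + c.2.toNat ≤ c.1))
      (g := fun c => !(c.2 && decide (c.1 = 0)))
      (d := fun x => (x.1.1 / 2, if decide (x.1.1 % 2 = 1) = true then x.2.1 && x.1.2
        else x.2.1 || x.1.2))
      (h := fun x => x.2.2.2)
      (not (PTime.snd.and (decide_eq PTime.fst (const 0)))) ?_ 
      (PTime.snd.comp (PTime.snd.comp PTime.snd)) ?_ ?_ ?_ ?_
    · have y : PTime (fun x : (ℕ × Bool) × Bool × ℕ => x.1.1) := PTime.fst.comp PTime.fst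
      have s : PTime (fun x : (ℕ × Bool) × Bool × ℕ => x.1.2) := PTime.snd.comp PTime.fst
      have b : PTime (fun x : (ℕ × Bool) × Bool × ℕ => x.2.1) := PTime.fst.comp PTime.snd
      exact (half y).pair (ite (odd y) (b.and s) (b.or s))
    · exact ⟨3, fun c l => by simpa using esize_bool_le _⟩
    · intro c a l
      have h1 := esize_half_le c.1
      have h2 := esize_pos c.2
      have h3 := esize_pos a
      refine le_trans (Nat.add_le_add_right (Nat.add_le_add h1 (esize_bool_le _)) 1) ?_
      rw [esize_pair]
      omega
    · rintro ⟨y, s⟩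
      cases s <;> simp [Nat.one_le_iff_ne_zero]
    · rintro ⟨y, s⟩ n hn
      rcases Nat.mod_two_eq_zero_or_one n with h | h <;>
      rcases Nat.mod_two_eq_zero_or_one y with h' | h' <;> cases s <;> simp [h, h'] <;> omega
  exact this.comp ((hn.pair (const false)).pair hm)

/-- Digitwise subtraction with borrow. Truncation at zero is not a digitwise operation, so every
level first compares the numbers. -/
theorem sub {m n : γ → ℕ} (hm : PTime m) (hn : PTime n) : PTime (fun c => m c - n c) := by
  have : PTime (fun x : (ℕ × Bool) × ℕ => x.2 - (x.1.1 + x.1.2.toNat)) := by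
    refine natRec (f := fun c x => x - (c.1 + c.2.toNat))
      (g := fun c => 0)
      (d := fun x => (x.1.1 / 2, if x.2.1 = true then decide (x.1.1 % 2 = 1) && x.1.2
        else decide (x.1.1 % 2 = 1) || x.1.2))
      (h := fun x => if x.1.1 + x.1.2.toNat ≤ 2 * x.2.2.1 + x.2.1.toNat then 2 * x.2.2.2 +
        (decide ((decide (x.2.1 = decide (x.1.1 % 2 = 1))) = x.1.2)).toNat else 0)
      (const 0) ?_ ?_ ?_ ?_ ?_ ?_
    · have y : PTime (fun x : (ℕ × Bool) × Bool × ℕ => x.1.1) := PTime.fst.comp PTime.fst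
      have s : PTime (fun x : (ℕ × Bool) × Bool × ℕ => x.1.2) := PTime.snd.comp PTime.fst
      have b : PTime (fun x : (ℕ × Bool) × Bool × ℕ => x.2.1) := PTime.fst.comp PTime.snd
      exact (half y).pair (ite b ((odd y).and s) ((odd y).or s))
    · have y : PTime (fun x : (ℕ × Bool) × Bool × ℕ × ℕ => x.1.1) := PTime.fst.comp PTime.fst
      have s : PTime (fun x : (ℕ × Bool) × Bool × ℕ × ℕ => x.1.2) := PTime.snd.comp PTime.fst
      have b : PTime (fun x : (ℕ × Bool) × Bool × ℕ × ℕ => x.2.1) := PTime.fst.comp PTime.snd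
      exact ite_prop (decide_le (add y (boolToNat s))
          (ofBit (PTime.fst.comp (PTime.snd.comp PTime.snd)) b))
        (ofBit (PTime.snd.comp (PTime.snd.comp PTime.snd)) (decide_eq (decide_eq b (odd y)) s))
        (const 0)
    · refine ⟨4 * Polynomial.X + 10, fun c n => ?_⟩
      have h1 := esize_nat_le_of_le (Nat.sub_le n (c.1 + c.2.toNat))
      simp only [esize_pair, Polynomial.eval_add, Polynomial.eval_mul, Polynomial.eval_X,
        Polynomial.eval_ofNat]
      omega
    · intro c a l
      have h1 := esize_half_le c.1
      have h2 := esize_pos c.2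
      have h3 := esize_pos a
      refine le_trans (Nat.add_le_add_right (Nat.add_le_add h1 (esize_bool_le _)) 1) ?_
      rw [esize_pair]
      omega
    · simp
    · rintro ⟨y, s⟩ n hn
      rcases Nat.mod_two_eq_zero_or_one n with h | h <;>
      rcases Nat.mod_two_eq_zero_or_one y with h' | h' <;> cases s <;> simp [h, h'] <;>
        split_ifs <;> omega
  exact this.comp ((hn.pair (const false)).pair hm)

theorem mul {m n : γ → ℕ} (hm : PTime m) (hn : PTime n) : PTime (fun c => m c * n c) := by
  have : PTime (fun x : ℕ × ℕ => x.2 * x.1) := by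
    refine natRec (f := fun c x => x * c) (g := fun c => 0) (d := fun x => x.1)
      (h := fun x => (2 * x.2.2.2 + false.toNat) + (if x.2.1 = true then x.1 else 0))
      (const 0) PTime.fst (add (ofBit (PTime.snd.comp (PTime.snd.comp PTime.snd)) (const _))
        (ite (PTime.fst.comp PTime.snd) PTime.fst (const _)))
      ⟨4 * Polynomial.X + 10, fun c n => ?_⟩ (fun c a l => by dsimp only; omega)
      (fun c => by simp) fun c n hn => ?_
    · have h1 := (esize_nat_bounds (n * c)).2
      have h2 := (esize_nat_bounds n).1
      have h2' := (esize_nat_bounds c).1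
      have h3 := Nat.size_mul_le n c
      simp only [esize_pair, Polynomial.eval_add, Polynomial.eval_mul, Polynomial.eval_X,
        Polynomial.eval_ofNat]
      omega
    · obtain ⟨m, h | h⟩ := Nat.even_or_odd' n
      · have h1 : n % 2 = 0 := by omega
        have h2 : n / 2 = m := by omega
        simp only [h1, h2]
        rw [h]; simp [mul_assoc]
      · have h1 : n % 2 = 1 := by omega
        have h2 : n / 2 = m := by omega
        simp only [h1, h2]
        rw [h]; simp [add_mul, mul_assoc]
  convert this.comp (hm.pair hn) using 2
  simp [mul_comm]

theorem sum {l : γ → List ℕ} (hl : PTime l) : PTime (fun c => (l c).sum) := by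
  simp only [List.sum_eq_foldr]
  refine foldr (step := fun _ a r => a + r) (init := fun _ => 0) hl
    (add (PTime.fst.comp PTime.snd) (PTime.snd.comp PTime.snd)) (const _)
    ⟨4 * Polynomial.X + 1, fun c l => ?_⟩
  rw [← List.sum_eq_foldr]
  have h : l.sum.size ≤ esize l := by
    induction l with
    | nil => simp
    | cons a l ih =>
      have h1 := Nat.size_add_le a l.sum
      have h2 := (esize_nat_bounds a).1
      rw [List.sum_cons, esize_cons]
      omega
  have := (esize_nat_bounds l.sum).2
  simp only [esize_pair, Polynomial.eval_add, Polynomial.eval_mul, Polynomial.eval_X,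
    Polynomial.eval_ofNat, Polynomial.eval_one]
  omega

theorem natAbs {z : γ → ℤ} (hz : PTime z) : PTime (fun c => (z c).natAbs) :=
  ((PTime.snd (α := Bool) (β := ℕ)).congr_enc (fun z : ℤ => (decide (z < 0), z.natAbs))
    (fun _ => rfl) (g := Int.natAbs) fun _ => rfl).comp hz

theorem decide_neg {z : γ → ℤ} (hz : PTime z) : PTime (fun c => decide (z c < 0)) :=
  ((PTime.fst (α := Bool) (β := ℕ)).congr_enc (fun z : ℤ => (decide (z < 0), z.natAbs))
    (fun _ => rfl) (g := fun z : ℤ => decide (z < 0)) fun _ => rfl).comp hz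

theorem natCast {n : γ → ℕ} (hn : PTime n) : PTime (fun c => (n c : ℤ)) :=
  ((const false).pair hn).congr_enc (fun c => c) (fun _ => rfl) fun c => by
    have h : ¬ ((n c : ℤ) < 0) := by omega
    simp [enc, encodeInt, h]

/-- At least one of the two truncated differences vanishes, so their sum is the absolute value.
Integer addition and subtraction reduce to this by splitting into positive and negative parts. -/
theorem natSub {m n : γ → ℕ} (hm : PTime m) (hn : PTime n) :
    PTime (fun c => (m c : ℤ) - (n c : ℤ)) := by
  refine ((not (decide_le hn hm)).pair (add (sub hm hn) (sub hn hm))).congr_enc (fun c => c)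
    (fun _ => rfl) fun c => ?_
  change Data.cons (encodeBool _) (encodeNat _) = Data.cons (encodeBool _) (encodeNat _)
  congr 2
  · by_cases h : n c ≤ m c <;> simp [h]
    omega
  · omega

theorem toNat {z : γ → ℤ} (hz : PTime z) : PTime (fun c => (z c).toNat) := by
  convert ite (decide_neg hz) (const 0) (natAbs hz) using 2 with c
  simp only [decide_eq_true_eq]
  split_ifs <;> omega

theorem negToNat {z : γ → ℤ} (hz : PTime z) : PTime (fun c => (-z c).toNat) := by
  convert ite (decide_neg hz) (natAbs hz) (const 0) using 2 with c
  simp only [decide_eq_true_eq]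
  split_ifs <;> omega

theorem intAdd {y z : γ → ℤ} (hy : PTime y) (hz : PTime z) : PTime (fun c => y c + z c) := by
  convert natSub (add (toNat hy) (toNat hz)) (add (negToNat hy) (negToNat hz)) using 2 with c
  omega

theorem intSub {y z : γ → ℤ} (hy : PTime y) (hz : PTime z) : PTime (fun c => y c - z c) := by
  convert natSub (add (toNat hy) (negToNat hz)) (add (negToNat hy) (toNat hz)) using 2 with c
  omega

theorem intDecide_lt {y z : γ → ℤ} (hy : PTime y) (hz : PTime z) :
    PTime (fun c => decide (y c < z c)) := by
  convert decide_neg (intSub hy hz) using 3 with c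
  simp

/-! #### Constants -/

theorem num {z : γ → ℤ} (hz : PTime z) : PTime (fun c => Const.num (z c)) :=
  ((const false).pair hz).congr_enc (fun c => c) (fun _ => rfl) fun _ => rfl

/-- The value is a number. -/
def _root_.Const.isNum : Const → Bool
  | .num _ => true
  | .sym _ => false

theorem isNum {f : γ → Const} (hf : PTime f) : PTime (fun c => (f c).isNum) := by
  refine case (γ := Bool) (δ := Data) (f := fun _ => false) (g := fun x => !x.1) hf (const _)
    (not PTime.fst) fun c => .inr ?_
  cases f c with
  | num z => exact ⟨false, enc z, rfl, rfl⟩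
  | sym s => exact ⟨true, enc s, rfl, rfl⟩

theorem toInt {f : γ → Const} (hf : PTime f) : PTime (fun c => (f c).toInt) := by
  -- The tag decides whether the payload is an integer or a string, so the case distinction is made
  -- on raw trees.
  have : PTime (fun c => enc (f c).toInt) := by
    refine case (γ := Bool) (δ := Data) (f := fun _ => Data.nil)
      (g := fun x => if x.1 = true then enc (0 : ℤ) else x.2.1) hf (const _)
      (ite PTime.fst (const _) (PTime.fst.comp PTime.snd)) fun c => .inr ?_
    cases f c with
    | num z => exact ⟨false, enc z, rfl, rfl⟩
    | sym s => exact ⟨true, enc s, rfl, rfl⟩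
  exact this.congr_enc (fun c => c) (fun _ => rfl) fun _ => rfl

end PTime

/-! ### Fixes of tuples -/

section LocalFixes
variable {S : Schema} (IC : Finset (OneAtomDenial S)) {R : Fin S.numRel}

/-- The tuple `u` of `R` does not violate the denials. -/
def LocalSat (u : Row S R) : Prop :=
  ∀ ic ∈ IC, ∀ β : Fin ic.n → Const,
    (⟨ic.atom.rel, fun A => (ic.atom.args A).eval β⟩ : DBFact S) = ⟨R, u⟩ →
      ¬ ∀ b ∈ ic.builtins, b.Holds β

/-- The tuple `u` may replace `t` in a fix. -/
structure IsLocalFix (t u : Row S R) : Prop where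
  rigid : ∀ A, A ∉ S.fixable R → u A = t A
  typed : ∀ A ∈ S.fixable R, ∃ z : ℤ, u A = Const.num z
  sat : LocalSat IC u

/-- The square distance of two tuples. -/
def rowDist (t u : Row S R) : ℤ := ∑ A ∈ S.fixable R, ((t A).toInt - (u A).toInt) ^ 2

/-- The tuple `u` may replace `t`, at minimum distance. -/
def IsLocalLSFix (t u : Row S R) : Prop :=
  IsLocalFix IC t u ∧ ∀ w, IsLocalFix IC t w → rowDist t u ≤ rowDist t w

variable {IC}

theorem sameKey_of_rigid {t u : Row S R} (h : ∀ A, A ∉ S.fixable R → u A = t A) :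
    SameKey t u :=
  fun A hA => (h A (Finset.disjoint_left.1 (S.key_rigid R) hA)).symm

theorem IsLocalFix.sameKey {t u : Row S R} (h : IsLocalFix IC t u) : SameKey t u :=
  sameKey_of_rigid h.rigid

/-- The place where the one-atom form matters: a violation involves only one tuple. -/
theorem sat_iff_localSat {D : Database S} :
    (∀ ic ∈ IC, ic.Sat D) ↔ ∀ R, ∀ u ∈ D R, LocalSat IC u := by
  constructor
  · intro h R u hu ic hic β hβ hb
    refine h ic hic β ⟨?_, hb⟩
    obtain ⟨rfl, h2⟩ := Sigma.mk.inj_iff.1 hβ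
    rw [DBAtom.Holds, eq_of_heq h2]
    exact hu
  · intro h ic hic β hβ
    exact h _ _ hβ.1 ic hic β rfl hβ.2

/-- The database in which each tuple is replaced as prescribed by `g`. -/
def replaceRows (D : Database S) (g : ∀ R, Row S R → Row S R) : Database S :=
  fun R => (D R).image (g R)

theorem mem_replaceRows {D : Database S} {g : ∀ R, Row S R → Row S R} {u : Row S R} :
    u ∈ replaceRows D g R ↔ ∃ t ∈ D R, g R t = u := Finset.mem_image

theorem SameKey.symm {t u : Row S R} (h : SameKey t u) : SameKey u t :=
  fun A hA => (h A hA).symm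

theorem SameKey.trans {t u v : Row S R} (h : SameKey t u) (h' : SameKey u v) : SameKey t v :=
  fun A hA => (h A hA).trans (h' A hA)

variable {D : Database S}

/-- Independent local choices never collide, because replacements keep the keys and these differ in
`D`. -/
theorem isFix_replaceRows (hD : IsInstance D) {g : ∀ R, Row S R → Row S R}
    (hg : ∀ R, ∀ t ∈ D R, IsLocalFix IC t (g R t)) : IsFix IC D (replaceRows D g) where
  isInstance :=
    { typed := by
        intro R u hu A hA
        obtain ⟨t, ht, rfl⟩ := mem_replaceRows.1 hu
        exact (hg R t ht).typed A hA
      keys := by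
        intro R u hu u' hu' h
        obtain ⟨t, ht, rfl⟩ := mem_replaceRows.1 hu
        obtain ⟨t', ht', rfl⟩ := mem_replaceRows.1 hu'
        rw [hD.keys R t ht t' ht'
          (((hg R t ht).sameKey.trans h).trans (hg R t' ht').sameKey.symm)] }
  rigid_left R t ht := ⟨g R t, mem_replaceRows.2 ⟨t, ht, rfl⟩, (hg R t ht).rigid⟩
  rigid_right R u hu := by
    obtain ⟨t, ht, rfl⟩ := mem_replaceRows.1 hu
    exact ⟨t, ht, (hg R t ht).rigid⟩
  sat := by
    refine sat_iff_localSat.2 fun R u hu => ?_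
    obtain ⟨t, ht, rfl⟩ := mem_replaceRows.1 hu
    exact (hg R t ht).sat

/-- By the key constraint, `g R t` is the only new tuple with the key of `t`, so the innermost sum
over tuples has a single term. -/
theorem sqDist_replaceRows (hD : IsInstance D) {g : ∀ R, Row S R → Row S R}
    (hg : ∀ R, ∀ t ∈ D R, IsLocalFix IC t (g R t)) :
    sqDist D (replaceRows D g) = ∑ R, ∑ t ∈ D R, rowDist t (g R t) := by
  refine Finset.sum_congr rfl fun R _ => Finset.sum_congr rfl fun t ht => ?_
  have : (replaceRows D g R).filter (fun t' => SameKey t t') = {g R t} := by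
    ext u
    simp only [Finset.mem_filter, Finset.mem_singleton]
    constructor
    · rintro ⟨hu, h⟩
      exact (isFix_replaceRows hD hg).isInstance.keys R _ hu _ (mem_replaceRows.2 ⟨t, ht, rfl⟩)
        (h.symm.trans (hg R t ht).sameKey)
    · rintro rfl
      exact ⟨mem_replaceRows.2 ⟨t, ht, rfl⟩, (hg R t ht).sameKey⟩
  rw [this, Finset.sum_singleton, rowDist]

/-- Every tuple of `D'` shares its key with some `t` of `D`, and so coincides with the replacement
picked for `t`. -/
theorem IsFix.exists_replaceRows {D' : Database S} (h : IsFix IC D D') :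
    ∃ g : ∀ R, Row S R → Row S R, (∀ R, ∀ t ∈ D R, IsLocalFix IC t (g R t)) ∧
      D' = replaceRows D g := by
  classical
  choose! g hg hg' using h.rigid_left
  have hg'' : ∀ R, ∀ t ∈ D R, IsLocalFix IC t (g R t) := fun R t ht =>
    ⟨hg' R t ht, h.isInstance.typed R _ (hg R t ht), sat_iff_localSat.1 h.sat R _ (hg R t ht)⟩
  refine ⟨g, hg'', ?_⟩
  funext R
  ext u
  rw [mem_replaceRows]
  constructor
  · intro hu
    obtain ⟨t, ht, htu⟩ := h.rigid_right R u hu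
    exact ⟨t, ht, h.isInstance.keys R _ (hg R t ht) _ hu
      ((hg'' R t ht).sameKey.symm.trans (sameKey_of_rigid htu))⟩
  · rintro ⟨t, ht, rfl⟩
    exact hg R t ht

/-- The distance is a sum of independent terms, so it is minimal exactly when every term is. For the
direct implication, one tuple is exchanged and all the other terms cancel. -/
theorem isLSFix_replaceRows_iff (hD : IsInstance D) {g : ∀ R, Row S R → Row S R}
    (hg : ∀ R, ∀ t ∈ D R, IsLocalFix IC t (g R t)) :
    IsLSFix IC D (replaceRows D g) ↔ ∀ R, ∀ t ∈ D R, IsLocalLSFix IC t (g R t) := by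
  classical
  constructor
  · intro h R t ht
    refine ⟨hg R t ht, fun w hw => ?_⟩
    let g' : ∀ R, Row S R → Row S R := Function.update g R (Function.update (g R) t w)
    have e : ∀ R' t', ¬ (⟨R', t'⟩ : DBFact S) = ⟨R, t⟩ → g' R' t' = g R' t' := by
      intro R' t' hne
      by_cases hR : R' = R
      · subst hR
        have : t' ≠ t := fun h => hne (by rw [h])
        simp [g', this]
      · simp [g', hR]
    have e' : g' R t = w := by simp [g']
    have hg' : ∀ R, ∀ t ∈ D R, IsLocalFix IC t (g' R t) := by
      intro R' t' ht'
      by_cases hR : (⟨R', t'⟩ : DBFact S) = ⟨R, t⟩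
      · obtain ⟨rfl, h2⟩ := Sigma.mk.inj_iff.1 hR
        obtain rfl := eq_of_heq h2
        rwa [e']
      · rw [e _ _ hR]
        exact hg R' t' ht'
    have key := h.2 _ (isFix_replaceRows hD hg')
    rw [sqDist_replaceRows hD hg, sqDist_replaceRows hD hg', Finset.sum_sigma',
      Finset.sum_sigma'] at key
    have hmem : (⟨R, t⟩ : DBFact S) ∈ Finset.univ.sigma D := by simpa using ht
    rw [← Finset.add_sum_erase _ _ hmem, ← Finset.add_sum_erase _ _ hmem,
      Finset.sum_congr rfl (g := fun x : DBFact S => rowDist x.2 (g' x.1 x.2))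
        (s₂ := (Finset.univ.sigma D).erase ⟨R, t⟩) (fun x hx => by
          rw [e x.1 x.2 (Finset.ne_of_mem_erase hx)])] at key
    simpa [e'] using key
  · intro h
    refine ⟨isFix_replaceRows hD hg, fun D'' hD'' => ?_⟩
    obtain ⟨g', hg', rfl⟩ := hD''.exists_replaceRows
    rw [sqDist_replaceRows hD hg, sqDist_replaceRows hD hg']
    exact Finset.sum_le_sum fun R _ => Finset.sum_le_sum fun t ht => (h R t ht).2 _ (hg' R t ht)

theorem isLSFix_replaceRows (hD : IsInstance D) {g : ∀ R, Row S R → Row S R}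
    (hg : ∀ R, ∀ t ∈ D R, IsLocalLSFix IC t (g R t)) : IsLSFix IC D (replaceRows D g) :=
  (isLSFix_replaceRows_iff hD fun R t ht => (hg R t ht).1).2 hg

theorem IsLSFix.exists_replaceRows (hD : IsInstance D) {D' : Database S} (h : IsLSFix IC D D') :
    ∃ g : ∀ R, Row S R → Row S R, (∀ R, ∀ t ∈ D R, IsLocalLSFix IC t (g R t)) ∧
      D' = replaceRows D g := by
  obtain ⟨g, hg, rfl⟩ := h.1.exists_replaceRows
  exact ⟨g, (isLSFix_replaceRows_iff hD hg).1 h, rfl⟩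

theorem isLocalLSFix_of_mem_tupleFixes (hD : IsInstance D) {t u : Row S R} (ht : t ∈ D R)
    (hu : u ∈ tupleFixes IC D t) : IsLocalLSFix IC t u := by
  obtain ⟨hk, D', hD', hu⟩ := hu
  obtain ⟨g, hg, rfl⟩ := hD'.exists_replaceRows hD
  obtain ⟨t', ht', rfl⟩ := mem_replaceRows.1 hu
  rw [hD.keys R t ht t' ht' (hk.trans (hg R t' ht').1.sameKey.symm)]
  exact hg R t' ht'

/-- A given LS-fix supplies the replacements of the other tuples; without one, a local fix of `t`
need not extend to a fix of `D`. -/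
theorem mem_tupleFixes (hD : IsInstance D) (hex : ∃ D', IsLSFix IC D D') {t u : Row S R}
    (ht : t ∈ D R) (hu : IsLocalLSFix IC t u) : u ∈ tupleFixes IC D t := by
  classical
  obtain ⟨D', hD'⟩ := hex
  obtain ⟨g, hg, rfl⟩ := hD'.exists_replaceRows hD
  refine ⟨hu.1.sameKey, replaceRows D (Function.update g R (Function.update (g R) t u)),
    isLSFix_replaceRows hD fun R' t' ht' => ?_, mem_replaceRows.2 ⟨t, ht, by simp⟩⟩
  by_cases hR : R' = R
  · subst hR
    by_cases h : t' = t
    · subst h; simpa using hu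
    · simpa [h] using hg R' t' ht'
  · simpa [hR] using hg R' t' ht'

/-! ### Locality of the values in nearest fixes -/

/-- The number `z` occurs as a constant in the denials. -/
def OccursIn (IC : Finset (OneAtomDenial S)) (z : ℤ) : Prop :=
  ∃ ic ∈ IC, (∃ A, ic.atom.args A = .const (.num z)) ∨
    ∃ θ x, DenialBuiltin.cmp θ x (.num z) ∈ ic.builtins

theorem Cmp.holds_num_of_same_side {θ : Cmp} {v x c : ℤ} (hv : v ≠ c) (hx : x ≠ c)
    (h : v < c ↔ x < c) (hh : θ.Holds (.num v) (.num c)) : θ.Holds (.num x) (.num c) := by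
  cases θ <;> simp_all [Cmp.Holds] <;> omega

/-- A tuple that does not violate the denials still does not violate them after the change of a
number to a new one, if no constant of the denials is reached or passed. -/
theorem LocalSat.update {u : Row S R} (hu : LocalSat IC u) {A : Fin (S.arity R)} {x v : ℤ}
    (hx : u A = .num x) (hnew : ∀ B, B ≠ A → u B ≠ .num v)
    (hside : ∀ c, OccursIn IC c → v ≠ c ∧ x ≠ c ∧ (v < c ↔ x < c)) :
    LocalSat IC (Function.update u A (.num v)) := by
  intro ic hic β hβ hb
  obtain ⟨h1, h2⟩ := Sigma.mk.inj_iff.1 hβ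
  subst h1
  have h2 := congrFun (eq_of_heq h2)
  have hA := h2 A
  rw [Function.update_self] at hA
  have hocc : ∀ B, B ≠ A → (ic.atom.args B).eval β = u B := fun B hB => by
    rw [h2 B, Function.update_of_ne hB]
  cases hτ : ic.atom.args A with
  | const c =>
    rw [hτ, Trm.eval] at hA
    subst hA
    exact (hside v ⟨ic, hic, .inl ⟨A, hτ⟩⟩).1 rfl
  | var x₀ =>
    rw [hτ, Trm.eval] at hA
    -- As `v` is new in the tuple, no other variable of the atom has this value. So a violation by
    -- the new tuple pulls back to the old one by resetting `x₀` to `x`.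
    have honly : ∀ y, ic.atom.Occurs y → y ≠ x₀ → β y ≠ .num v := by
      rintro y ⟨B, hB⟩ hy
      have hBA : B ≠ A := by
        rintro rfl
        rw [hτ] at hB
        exact hy (Trm.var.inj hB).symm
      have := hocc B hBA
      rw [hB, Trm.eval] at this
      rw [this]
      exact hnew B hBA
    refine hu ic hic (Function.update β x₀ (.num x)) ?_ fun b hbm => ?_
    · congr 1
      funext B
      by_cases hB : B = A
      · subst hB
        rw [hτ, Trm.eval, Function.update_self, hx]
      · rw [← hocc B hB]
        cases hτB : ic.atom.args B with
        | const c => rfl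
        | var y =>
          have hy : y ≠ x₀ := by
            rintro rfl
            have h3 := hocc B hB
            rw [hτB, Trm.eval, hA] at h3
            exact hnew B hB h3.symm
          simp [Trm.eval, Function.update_of_ne hy]
    · have hbh := hb b hbm
      have hs := ic.safe b hbm
      cases b with
      | cmp θ y c =>
        simp only [DenialBuiltin.Holds] at hbh ⊢
        by_cases hy : y = x₀
        · subst hy
          rw [Function.update_self]
          rw [hA] at hbh
          cases c with
          | num c =>
            obtain ⟨g1, g2, g3⟩ := hside c ⟨ic, hic, .inr ⟨θ, _, hbm⟩⟩
            exact Cmp.holds_num_of_same_side g1 g2 g3 hbh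
          | sym s => cases θ <;> simp_all [Cmp.Holds]
        · rwa [Function.update_of_ne hy]
      | eq y z =>
        simp only [DenialBuiltin.Holds] at hbh ⊢
        have hsy := hs y (.inl rfl)
        have hsz := hs z (.inr rfl)
        by_cases hy : y = x₀ <;> by_cases hz : z = x₀
        · rw [hy, hz]
        -- An equality between `x₀` and another variable fails in the new tuple, so it cannot be
        -- part of a violation.
        · exact absurd (by rw [← hbh, hy, hA]) (honly z hsz hz)
        · exact absurd (by rw [hbh, hz, hA]) (honly y hsy hy)
        · rwa [Function.update_of_ne hy, Function.update_of_ne hz]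

/-- In a fix of a tuple at minimum distance, every value is close to the old one or to a constant of
the denials. -/
theorem IsLocalLSFix.value_near {t u : Row S R} (h : IsLocalLSFix IC t u) {A : Fin (S.arity R)}
    (hA : A ∈ S.fixable R) : ∃ j : ℤ, |j| ≤ S.arity R ∧
      ((u A).toInt = (t A).toInt + j ∨ ∃ c, OccursIn IC c ∧ (u A).toInt = c + j) := by
  by_contra hcon
  push Not at hcon
  obtain ⟨x, hx⟩ := h.1.typed A hA
  set a := (t A).toInt with ha
  have hxa : x ≠ a := fun e => (hcon 0 (by simp)).1 (by rw [hx]; simp [Const.toInt, e])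
  -- `ε` is the sign of `x - a`; subtracting multiples of it moves `x` towards the old value `a`.
  obtain ⟨ε, hε, hεx⟩ : ∃ ε : ℤ, (ε = 1 ∨ ε = -1) ∧ ε * (x - a) = |x - a| := by
    rcases lt_or_gt_of_ne hxa with hlt | hgt
    · exact ⟨-1, .inr rfl, by rw [abs_of_neg (by omega)]; ring⟩
    · exact ⟨1, .inl rfl, by rw [abs_of_pos (by omega)]; ring⟩
  have hfar : ∀ y : ℤ, |x - y| ≤ S.arity R → y ≠ a ∧ ¬ OccursIn IC y := fun y hy => by
    have := hcon (x - y) hy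
    rw [hx] at this
    simp only [Const.toInt] at this
    exact ⟨fun e => this.1 (by rw [← e]; ring), fun hc => this.2 y hc (by ring)⟩
  -- Pigeonhole: there are as many trial values as attributes, and only the attributes other than
  -- `A` can block one. If all were blocked, the injective map `B` would be onto and would hit `A`.
  obtain ⟨j, hj⟩ : ∃ j : Fin (S.arity R), ∀ B, B ≠ A → u B ≠ .num (x - ε * ((j : ℕ) + 1)) := by
    by_contra hno
    push Not at hno
    choose B hB hB' using hno
    have hinj : Function.Injective B := fun j j' hjj => by
      have h1 := hB' j
      rw [hjj, hB' j'] at h1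
      have h2 := Const.num.inj h1
      apply Fin.ext
      rcases hε with rfl | rfl <;> omega
    obtain ⟨j, hj⟩ := (Finite.injective_iff_surjective.1 hinj) A
    exact hB j hj
  set v := x - ε * ((j : ℕ) + 1) with hv
  have hjN := j.2
  have habs : |x - v| = (j : ℕ) + 1 := by
    rw [hv]; rcases hε with rfl | rfl
    · rw [abs_of_pos] <;> omega
    · rw [abs_of_neg] <;> omega
  have hloc : IsLocalFix IC t (Function.update u A (.num v)) := by
    refine ⟨fun B hB => ?_, fun B hB => ?_, h.1.sat.update hx hj fun c hc => ?_⟩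
    · rw [Function.update_of_ne (by rintro rfl; exact hB hA)]
      exact h.1.rigid B hB
    · by_cases hBA : B = A
      · subst hBA; exact ⟨v, by simp⟩
      · rw [Function.update_of_ne hBA]
        exact h.1.typed B hB
    · have hc' : ¬ |x - c| ≤ S.arity R := fun hle => (hfar c hle).2 hc
      rw [abs_le] at hc'
      have := abs_le.1 habs.le
      omega
  have hle := h.2 _ hloc
  rw [rowDist, rowDist, ← Finset.add_sum_erase _ _ hA, ← Finset.add_sum_erase _ _ hA,
    Finset.sum_congr rfl (g := fun B => ((t B).toInt - (u B).toInt) ^ 2)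
      (s₁ := (S.fixable R).erase A) (f := fun B => ((t B).toInt -
        (Function.update u A (.num v) B).toInt) ^ 2) (fun B hB => by
        rw [Function.update_of_ne (Finset.ne_of_mem_erase hB)])] at hle
  rw [Function.update_self, hx, add_le_add_iff_right, ← ha] at hle
  change (a - x) ^ 2 ≤ (a - v) ^ 2 at hle
  -- The distance from `x` to `a` exceeds the arity, hence the shift `j + 1`. So `v` lies strictly
  -- between `a` and `x`, which contradicts minimality.
  have hfa : ¬ |x - a| ≤ S.arity R := fun hle => (hfar a hle).1 rfl
  rw [← hεx] at hfa
  rcases hε with rfl | rfl <;> rw [hv] at hle <;> nlinarith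

end LocalFixes

/-! ### Enumeration of tuples -/

/-- The lists whose `i`-th element is taken from `L i`. -/
def piList {α : Type} : {n : ℕ} → (Fin n → List α) → List (List α)
  | 0, _ => [[]]
  | _ + 1, L => (L 0).flatMap fun x => (piList fun i => L i.succ).map fun l => x :: l

theorem mem_piList {α : Type} {n : ℕ} {L : Fin n → List α} {l : List α} :
    l ∈ piList L ↔ ∃ u : Fin n → α, (∀ i, u i ∈ L i) ∧ l = List.ofFn u := by
  induction n generalizing l with
  | zero => simp [piList]
  | succ n ih =>
    simp only [piList, List.mem_flatMap, List.mem_map, ih]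
    constructor
    · rintro ⟨x, hx, l, ⟨u, hu, rfl⟩, rfl⟩
      exact ⟨Fin.cons x u, Fin.cases hx hu, by simp [List.ofFn_succ]⟩
    · rintro ⟨u, hu, rfl⟩
      exact ⟨u 0, hu 0, _, ⟨fun i => u i.succ, fun i => hu i.succ, rfl⟩, by simp [List.ofFn_succ]⟩

theorem length_piList_le {α : Type} {n : ℕ} {L : Fin n → List α} {B : ℕ}
    (h : ∀ i, (L i).length ≤ B) : (piList L).length ≤ B ^ n := by
  induction n with
  | zero => simp [piList]
  | succ n ih =>
    have h0 := h 0
    have h1 := ih fun i => h i.succ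
    simp only [piList, List.length_flatMap, List.length_map, List.map_const', List.sum_replicate,
      smul_eq_mul, pow_succ']
    exact Nat.mul_le_mul h0 h1

/-- The list has product length, which is polynomial only because `n` is fixed. -/
theorem PTime.piList {α γ : Type} [DataEnc α] [DataEnc γ] {n : ℕ} {L : γ → Fin n → List α}
    (hL : ∀ i, PTime (fun c => L c i)) : PTime (fun c => piList (L c)) := by
  induction n with
  | zero => exact const _
  | succ n ih =>
    exact flatMap (hL 0) (g := fun c x => (_root_.piList fun i => L c i.succ).map fun l => x :: l)
      (map (g := fun (c : γ × α) l => c.2 :: l) ((ih fun i => hL i.succ).comp PTime.fst)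
        (cons (PTime.snd.comp PTime.fst) PTime.snd))

/-! ### Greedy choice -/

theorem List.Forall₂.exists_of_mem_left {α β : Type} {r : α → β → Prop} {l : List α} {l' : List β}
    (h : List.Forall₂ r l l') {a : α} (ha : a ∈ l) : ∃ b ∈ l', r a b := by
  induction h with
  | nil => simp at ha
  | cons h _ ih =>
    rcases List.mem_cons.1 ha with rfl | ha
    · exact ⟨_, List.mem_cons_self, h⟩
    · obtain ⟨b, hb, hab⟩ := ih ha
      exact ⟨b, List.mem_cons_of_mem _ hb, hab⟩

theorem List.card_mul_sum_le {α ι : Type} (items : List ι) {B : Finset α} {φ : ι → ℕ} {ψ : α → ι → ℕ}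
    (h : ∀ i, B.card * φ i ≤ ∑ g ∈ B, ψ g i) :
    B.card * (items.map φ).sum ≤ ∑ g ∈ B, (items.map (ψ g)).sum := by
  induction items with
  | nil => simp
  | cons i l ih =>
    simp only [List.map_cons, List.sum_cons, Finset.sum_add_distrib, mul_add]
    exact Nat.add_le_add (h i) ih

/-- All the elements of `l` are in `l'`. -/
def allMem {α : Type} [DecidableEq α] (l l' : List α) : Bool := l.all fun f => decide (f ∈ l')

theorem allMem_iff {α : Type} [DecidableEq α] {l l' : List α} :
    allMem l l' = true ↔ ∀ f ∈ l, f ∈ l' := by simp [allMem]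

section Greedy
variable {α ι : Type} [DecidableEq α] (Bs : List (List α))

/-- No block contains different elements of `l` and `l'`. -/
def compatible (l l' : List α) : Bool :=
  Bs.all fun B => l.all fun f => l'.all fun g =>
    !(decide (f ∈ B) && decide (g ∈ B)) || decide (f = g)

theorem compatible_iff {l l' : List α} : compatible Bs l l' = true ↔
    ∀ B ∈ Bs, ∀ f ∈ l, ∀ g ∈ l', f ∈ B → g ∈ B → f = g := by
  simp only [compatible, List.all_eq_true, Bool.or_eq_true, Bool.not_eq_true',
    Bool.and_eq_false_iff, decide_eq_false_iff_not, decide_eq_true_eq]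
  refine forall₂_congr fun B _ => forall₂_congr fun f _ => forall₂_congr fun g _ => ?_
  tauto

/-- The elements `l` can be chosen together with `dec`. -/
def admissible (dec l : List α) : Bool :=
  allMem l Bs.flatten && compatible Bs l l && compatible Bs l dec

/-- A power of `k` for the elements that have been chosen. -/
def weight (k : ℕ) (dec l : List α) : ℕ := (l.map fun f => if f ∈ dec then k else 1).prod

variable (k : ℕ) (items : List ι) (fs : ι → List α) (w : ι → ℕ)

/-- A lower estimate of the expected weight of a random completion of the choices `dec`, scaled. -/
def potential (dec : List α) : ℕ :=
  (items.map fun i => if admissible Bs dec (fs i) = true then weight k dec (fs i) * w i else 0).sum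

/-- Choose an element of `B` that maximizes the potential. -/
def greedyStep (B dec : List α) : List α :=
  (B.filter fun f => B.all fun g => decide
    (potential Bs k items fs w (g :: dec) ≤ potential Bs k items fs w (f :: dec))).take 1 ++ dec

/-- The greedy choice of an element of each block. -/
def greedy : List α := Bs.foldr (greedyStep Bs k items fs w) []

variable {Bs k}

theorem weight_le_weight_cons (hk : 1 ≤ k) (g : α) (dec l : List α) :
    weight k dec l ≤ weight k (g :: dec) l := by
  induction l with
  | nil => simp [weight]
  | cons f l ih =>
    simp only [weight, List.map_cons, List.prod_cons] at ih ⊢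
    refine Nat.mul_le_mul ?_ ih
    by_cases h : f ∈ dec
    · simp [h]
    · simp only [h, if_false]
      split_ifs <;> omega

/-- Each occurrence of the newly chosen `g` turns a factor 1 into `k`; further occurrences only
help. -/
theorem mul_weight_le_weight_cons (hk : 1 ≤ k) {g : α} {dec l : List α} (hg : g ∈ l)
    (hg' : g ∉ dec) : k * weight k dec l ≤ weight k (g :: dec) l := by
  induction l with
  | nil => simp at hg
  | cons f l ih =>
    have hle := weight_le_weight_cons hk g dec l
    simp only [weight, List.map_cons, List.prod_cons] at ih hle ⊢
    by_cases hf : f = g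
    · subst hf
      simpa [hg'] using Nat.mul_le_mul_left k hle
    · have := ih ((List.mem_cons.1 hg).resolve_left (Ne.symm hf))
      have e : (f ∈ g :: dec) ↔ f ∈ dec := by simp [hf]
      simp only [e]
      rw [mul_left_comm]
      exact Nat.mul_le_mul_left _ this

/-- The method of conditional expectations: the average of the new potentials over the block is at
least the old potential. This is checked for each item separately. -/
theorem exists_potential_le {B dec : List α}
    (hdisj : ∀ B' ∈ Bs, ∀ f ∈ B, f ∈ B' → B' = B) (hne : B ≠ []) (hcard : B.toFinset.card ≤ k)
    (hdec : ∀ f ∈ B, f ∉ dec) :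
    ∃ f ∈ B, potential Bs k items fs w dec ≤ potential Bs k items fs w (f :: dec) := by
  have hne' : B.toFinset.Nonempty := by simpa [List.toFinset_nonempty_iff] using hne
  have hk : 1 ≤ k := hne'.card_pos.trans_le hcard
  suffices h : B.toFinset.card * potential Bs k items fs w dec ≤
      ∑ g ∈ B.toFinset, potential Bs k items fs w (g :: dec) by
    obtain ⟨f, hf, hle⟩ := Finset.exists_le_of_sum_le hne'
      (f := fun _ => potential Bs k items fs w dec) (by simpa using h)
    exact ⟨f, List.mem_toFinset.1 hf, hle⟩
  refine List.card_mul_sum_le items fun i => ?_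
  by_cases hadm : admissible Bs dec (fs i) = true
  swap
  · simp [hadm]
  rw [if_pos hadm]
  simp only [admissible, Bool.and_eq_true, compatible_iff] at hadm
  obtain ⟨⟨h1, h2⟩, h3⟩ := hadm
  -- If the item uses an element `g` of the block, the choice of `g` alone multiplies its weight by
  -- `k`, which is at least the size of the block. If it uses none, disjointness of the blocks keeps
  -- it admissible under every choice.
  by_cases hex : ∃ g ∈ fs i, g ∈ B
  · obtain ⟨g, hg, hgB⟩ := hex
    have hg' : admissible Bs (g :: dec) (fs i) = true := by
      simp only [admissible, Bool.and_eq_true, compatible_iff]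
      refine ⟨⟨h1, h2⟩, fun B' hB' f hf f' hf' hfB hfB' => ?_⟩
      rcases List.mem_cons.1 hf' with rfl | hf'
      · exact h2 B' hB' f hf _ hg hfB hfB'
      · exact h3 B' hB' f hf f' hf' hfB hfB'
    refine le_trans ?_ (Finset.single_le_sum (fun _ _ => Nat.zero_le _)
      (List.mem_toFinset.2 hgB))
    rw [if_pos hg', ← mul_assoc]
    exact Nat.mul_le_mul_right _ ((Nat.mul_le_mul_right _ hcard).trans
      (mul_weight_le_weight_cons hk hg (hdec g hgB)))
  · push Not at hex
    rw [← smul_eq_mul]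
    refine Finset.card_nsmul_le_sum _ _ _ fun g hg => ?_
    have hgB := List.mem_toFinset.1 hg
    have hg' : admissible Bs (g :: dec) (fs i) = true := by
      simp only [admissible, Bool.and_eq_true, compatible_iff]
      refine ⟨⟨h1, h2⟩, fun B' hB' f hf f' hf' hfB hfB' => ?_⟩
      rcases List.mem_cons.1 hf' with rfl | hf'
      · rw [hdisj B' hB' _ hgB hfB'] at hfB
        exact absurd hfB (hex f hf)
      · exact h3 B' hB' f hf f' hf' hfB hfB'
    rw [if_pos hg']
    exact Nat.mul_le_mul_right _ (weight_le_weight_cons hk g dec _)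

theorem greedyStep_spec {B dec : List α}
    (hdisj : ∀ B' ∈ Bs, ∀ f ∈ B, f ∈ B' → B' = B) (hne : B ≠ []) (hcard : B.toFinset.card ≤ k)
    (hdec : ∀ f ∈ B, f ∉ dec) :
    ∃ f ∈ B, greedyStep Bs k items fs w B dec = f :: dec ∧
      potential Bs k items fs w dec ≤ potential Bs k items fs w (f :: dec) := by
  obtain ⟨f₀, hf₀, hle⟩ := exists_potential_le items fs w hdisj hne hcard hdec
  obtain ⟨f₁, hf₁, hmax⟩ := Finset.exists_max_image B.toFinset
    (fun f => potential Bs k items fs w (f :: dec)) ⟨f₀, List.mem_toFinset.2 hf₀⟩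
  unfold greedyStep
  set l := B.filter fun f => B.all fun g => decide
    (potential Bs k items fs w (g :: dec) ≤ potential Bs k items fs w (f :: dec)) with hl
  have hmem : f₁ ∈ l := by
    simp only [hl, List.mem_filter, List.all_eq_true, decide_eq_true_eq]
    exact ⟨List.mem_toFinset.1 hf₁, fun g hg => hmax g (List.mem_toFinset.2 hg)⟩
  cases hl' : l with
  | nil => simp [hl'] at hmem
  | cons f l' =>
    have hf : f ∈ l := by simp [hl']
    simp only [hl, List.mem_filter, List.all_eq_true, decide_eq_true_eq] at hf
    exact ⟨f, hf.1, by simp, hle.trans (hf.2 f₀ hf₀)⟩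

/-- The induction runs over suffixes, since the fold treats the last block first while the potential
always refers to all the blocks. -/
theorem foldr_greedyStep_spec (hdisj : Bs.Pairwise List.Disjoint)
    (hBs : ∀ B ∈ Bs, B ≠ [] ∧ B.toFinset.card ≤ k) (T : List (List α)) (hT : T <:+ Bs) :
    List.Forall₂ (fun f B => f ∈ B) (T.foldr (greedyStep Bs k items fs w) []) T ∧
      potential Bs k items fs w [] ≤
        potential Bs k items fs w (T.foldr (greedyStep Bs k items fs w) []) := by
  have : Std.Symm (List.Disjoint (α := α)) := ⟨fun _ _ h => h.symm⟩
  induction T with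
  | nil => simp
  | cons B T ih =>
    obtain ⟨ih₁, ih₂⟩ := ih ((List.suffix_cons B T).trans hT)
    have hB : B ∈ Bs := hT.subset List.mem_cons_self
    have hsub : (B :: T).Pairwise List.Disjoint := hdisj.sublist hT.sublist
    obtain ⟨f, hf, he, hle⟩ := greedyStep_spec items fs w (k := k) (fun B' hB' f hf hf' => by
        by_contra hne
        exact (hdisj.forall hB' hB hne) hf' hf) (hBs B hB).1 (hBs B hB).2
      (dec := T.foldr (greedyStep Bs k items fs w) []) (fun f hf hf' => by
        obtain ⟨B', hB', hfB'⟩ := ih₁.exists_of_mem_left hf'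
        exact (List.rel_of_pairwise_cons hsub hB') hf hfB')
    rw [List.foldr_cons, he]
    exact ⟨.cons hf ih₁, ih₂.trans hle⟩

/-- The greedy choice reaches at least the fraction `k⁻ᵐ` of the weight of all the items that are
compatible with the blocks. -/
theorem greedy_spec {m : ℕ} (hdisj : Bs.Pairwise List.Disjoint)
    (hBs : ∀ B ∈ Bs, B ≠ [] ∧ B.toFinset.card ≤ k) (hm : ∀ i, (fs i).length = m) :
    List.Forall₂ (fun f B => f ∈ B) (greedy Bs k items fs w) Bs ∧
      (items.map fun i => if admissible Bs [] (fs i) = true then w i else 0).sum ≤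
        k ^ m * (items.map fun i => if allMem (fs i) (greedy Bs k items fs w) = true
          then w i else 0).sum := by
  obtain ⟨h1, h2⟩ := foldr_greedyStep_spec items fs w hdisj hBs Bs List.suffix_rfl
  refine ⟨h1, le_trans (le_of_eq ?_) (h2.trans ?_)⟩
  -- With nothing chosen, all the factors are 1 and the potential is the total weight.
  · simp [potential, weight]
  change potential Bs k items fs w (greedy Bs k items fs w) ≤ _
  rw [← List.sum_map_mul_left]
  refine List.sum_le_sum fun i _ => ?_
  split_ifs with hadm hall
  · rw [weight, List.map_congr_left (g := fun _ => k)]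
    · simp [hm i]
    · intro f hf
      rw [allMem] at hall
      rw [if_pos (by simpa using List.all_eq_true.1 hall f hf)]
  -- Once every block has a chosen element, each fact of an admissible item lies in some block and
  -- must equal the element chosen there.
  · refine absurd (List.all_eq_true.2 fun f hf => ?_) hall
    simp only [admissible, allMem, Bool.and_eq_true, compatible_iff, List.all_eq_true,
      decide_eq_true_eq, List.mem_flatten] at hadm ⊢
    obtain ⟨B, hB, hfB⟩ := hadm.1.1 f hf
    obtain ⟨g, hg, hgB⟩ := h1.flip.exists_of_mem_left hB
    rw [hadm.2 B hB f hf g hg hfB hgB]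
    exact hg
  · exact Nat.zero_le _
  · simp

end Greedy

/-! ### Evaluation on lists of constants -/

/-- A fact, given by the number of its relation and the list of its values. -/
abbrev RawFact : Type := ℕ × List Const

section Raw
variable {S : Schema} {n : ℕ}

/-- The fact without its type. -/
def rawFact (f : DBFact S) : RawFact := (f.1, List.ofFn f.2)

/-- Allows programs to compare facts without their dependent types. -/
theorem rawFact_injective : Function.Injective (rawFact (S := S)) := by
  rintro ⟨R, t⟩ ⟨R', t'⟩ h
  simp only [rawFact, Prod.mk.injEq] at h
  obtain rfl := Fin.ext h.1
  rw [List.ofFn_injective h.2]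

/-- The value of a term under an assignment that is given as a list. -/
def Trm.evalList (β : List Const) : Trm n → Const
  | .var x => β.getD x (.num 0)
  | .const c => c

theorem Trm.evalList_ofFn (β : Fin n → Const) (τ : Trm n) :
    τ.evalList (List.ofFn β) = τ.eval β := by
  cases τ <;> simp [evalList, eval]

/-- The instance of an atom under an assignment. -/
def DBAtom.instRaw (a : DBAtom S n) (β : List Const) : RawFact :=
  (a.rel, List.ofFn fun A => (a.args A).evalList β)

theorem DBAtom.instRaw_ofFn (a : DBAtom S n) (β : Fin n → Const) :
    a.instRaw (List.ofFn β) = rawFact ⟨a.rel, fun A => (a.args A).eval β⟩ := by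
  simp [instRaw, rawFact, Trm.evalList_ofFn]

/-- The decision procedure for comparisons. -/
def Cmp.holdsBool (θ : Cmp) (a b : Const) : Bool :=
  match θ with
  | .eq => decide (a = b)
  | .ne => !decide (a = b)
  | .lt => a.isNum && b.isNum && decide (a.toInt < b.toInt)
  | .gt => a.isNum && b.isNum && decide (b.toInt < a.toInt)
  | .le => a.isNum && b.isNum && !decide (b.toInt < a.toInt)
  | .ge => a.isNum && b.isNum && !decide (a.toInt < b.toInt)

theorem Cmp.holdsBool_iff (θ : Cmp) (a b : Const) : θ.holdsBool a b = true ↔ θ.Holds a b := by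
  cases θ <;> cases a <;> cases b <;> simp [holdsBool, Holds, Const.isNum, Const.toInt]
  · exact decide_eq_true_iff
  · exact decide_eq_true_iff
  · exact decide_eq_false_iff_not.trans not_lt
  · exact decide_eq_false_iff_not.trans not_lt

/-- A built-in atom of a denial, as a comparison of terms. -/
def DenialBuiltin.toCmp : DenialBuiltin n → Cmp × Trm n × Trm n
  | .cmp θ x c => (θ, .var x, .const c)
  | .eq x y => (.eq, .var x, .var y)

/-- All the comparisons hold. -/
def comparisonsHold (bs : List (Cmp × Trm n × Trm n)) (β : List Const) : Bool :=
  bs.all fun b => b.1.holdsBool (b.2.1.evalList β) (b.2.2.evalList β)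

theorem comparisonsHold_ofFn (bs : List (Cmp × Trm n × Trm n)) (β : Fin n → Const) :
    comparisonsHold bs (List.ofFn β) = true ↔
      ∀ b ∈ bs, b.1.Holds (b.2.1.eval β) (b.2.2.eval β) := by
  simp [comparisonsHold, Cmp.holdsBool_iff, Trm.evalList_ofFn]

theorem comparisonsHold_toCmp (bs : List (DenialBuiltin n)) (β : Fin n → Const) :
    comparisonsHold (bs.map DenialBuiltin.toCmp) (List.ofFn β) = true ↔ ∀ b ∈ bs, b.Holds β := by
  rw [comparisonsHold_ofFn, List.forall_mem_map]
  refine forall₂_congr fun b _ => ?_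
  cases b <;> rfl

/-- The fact violates the denial. -/
def violates (ic : OneAtomDenial S) (f : RawFact) : Bool :=
  (piList fun _ : Fin ic.n => Const.num 0 :: f.2).any fun β =>
    decide (ic.atom.instRaw β = f) && comparisonsHold (ic.builtins.map DenialBuiltin.toCmp) β

theorem violates_iff (ic : OneAtomDenial S) (f : DBFact S) : violates ic (rawFact f) = true ↔
    ∃ β : Fin ic.n → Const, (⟨ic.atom.rel, fun A => (ic.atom.args A).eval β⟩ : DBFact S) = f ∧
      ∀ b ∈ ic.builtins, b.Holds β := by
  classical
  simp only [violates, List.any_eq_true, mem_piList, Bool.and_eq_true, decide_eq_true_eq]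
  constructor
  · rintro ⟨_, ⟨β, -, rfl⟩, h1, h2⟩
    rw [DBAtom.instRaw_ofFn] at h1
    exact ⟨β, rawFact_injective h1, (comparisonsHold_toCmp _ _).1 h2⟩
  · rintro ⟨β, rfl, h2⟩
    -- Variables outside the atom are irrelevant by safety. They are reset to `0`, which is why `0`
    -- is added to the values searched.
    have hocc : ∀ x, ic.atom.Occurs x →
        (if ic.atom.Occurs x then β x else Const.num 0) = β x := fun x hx => if_pos hx
    have hargs : (fun A => (ic.atom.args A).eval fun x =>
        if ic.atom.Occurs x then β x else Const.num 0) = fun A => (ic.atom.args A).eval β := by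
      funext A
      cases h : ic.atom.args A with
      | var x => exact hocc x ⟨A, h⟩
      | const c => rfl
    refine ⟨_, ⟨fun x => if ic.atom.Occurs x then β x else Const.num 0, fun x => ?_, rfl⟩, ?_, ?_⟩
    · dsimp only
      by_cases hx : ic.atom.Occurs x
      · rw [if_pos hx]
        obtain ⟨A, hA⟩ := hx
        refine List.mem_cons_of_mem _ ?_
        rw [rawFact, List.mem_ofFn]
        exact ⟨A, by simp [hA, Trm.eval]⟩
      · rw [if_neg hx]
        exact List.mem_cons_self
    · rw [DBAtom.instRaw_ofFn, hargs]
    · refine (comparisonsHold_toCmp _ _).2 fun b hb => ?_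
      have hs := ic.safe b hb
      have := h2 b hb
      cases b with
      | cmp θ x c =>
        rw [DenialBuiltin.Holds, hocc x (hs x rfl)]
        exact this
      | eq x y =>
        rw [DenialBuiltin.Holds, hocc x (hs x (.inl rfl)), hocc y (hs y (.inr rfl))]
        exact this

/-! ### The fixes of a tuple -/

/-- The numbers from `-N` to `N`. -/
def offsets (N : ℕ) : List ℤ := (List.range (2 * N + 1)).map fun i : ℕ => (i : ℤ) - N

theorem mem_offsets {N : ℕ} {j : ℤ} (h : |j| ≤ N) : j ∈ offsets N := by
  rw [abs_le] at h
  exact List.mem_map.2 ⟨(j + N).toNat, List.mem_range.2 (by omega), by omega⟩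

/-- The numbers close to `z` or to one of the numbers `cs`. -/
def nearValues (cs : List ℤ) (N : ℕ) (z : ℤ) : List Const :=
  ((offsets N).map fun j => Const.num (z + j)) ++
    cs.flatMap fun c => (offsets N).map fun j => Const.num (c + j)

variable (cs : List ℤ) (ics : List (OneAtomDenial S))

/-- The tuples that are considered as fixes of `t`. -/
def candidates (R : Fin S.numRel) (t : List Const) : List RawFact :=
  ((piList fun A : Fin (S.arity R) => if A ∈ S.fixable R then
    nearValues cs (S.arity R) (t.getD A (.num 0)).toInt else [t.getD A (.num 0)]).map fun u =>
      ((R : ℕ), u)).filter fun f => ics.all fun ic => !violates ic f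

/-- The square distance of two tuples. -/
def rawDist (R : Fin S.numRel) (t u : List Const) : ℕ :=
  (List.ofFn fun A : Fin (S.arity R) => if A ∈ S.fixable R then
    ((t.getD A (.num 0)).toInt - (u.getD A (.num 0)).toInt).natAbs *
      ((t.getD A (.num 0)).toInt - (u.getD A (.num 0)).toInt).natAbs else 0).sum

/-- The fixes of the tuple `t` of `R` at minimum distance. -/
def rowBlock (R : Fin S.numRel) (t : List Const) : List RawFact :=
  (candidates cs ics R t).filter fun f => (candidates cs ics R t).all fun g =>
    decide (rawDist R t f.2 ≤ rawDist R t g.2)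

/-- The fixes of a fact at minimum distance. -/
def block (f : RawFact) : List RawFact :=
  ((List.finRange S.numRel).map fun R : Fin S.numRel =>
    if f.1 = (R : ℕ) then rowBlock cs ics R f.2 else []).flatten

variable {cs ics}

theorem rawDist_ofFn {R : Fin S.numRel} (t u : Row S R) :
    (rawDist R (List.ofFn t) (List.ofFn u) : ℤ) = rowDist t u := by
  simp only [rawDist, rowDist, List.sum_ofFn, Nat.cast_sum]
  rw [← Finset.sum_filter_add_sum_filter_not Finset.univ (· ∈ S.fixable R)]
  rw [Finset.sum_eq_zero (s := Finset.univ.filter (· ∉ S.fixable R)), add_zero,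
    Finset.filter_mem_eq_inter, Finset.univ_inter]
  · refine Finset.sum_congr rfl fun A hA => ?_
    simp [hA, ← sq]
  · intro A hA
    simp [(Finset.mem_filter.1 hA).2]

variable {IC : Finset (OneAtomDenial S)} {R : Fin S.numRel}

/-- Every candidate is a genuine local fix, whatever `cs` is; that the nearest fixes are among them
needs `cs` to contain the constants. -/
theorem mem_candidates (hics : ∀ ic, ic ∈ ics ↔ ic ∈ IC) {t : Row S R} {f : RawFact} :
    f ∈ candidates cs ics R (List.ofFn t) ↔ ∃ u : Row S R, f = rawFact ⟨R, u⟩ ∧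
      IsLocalFix IC t u ∧ ∀ A ∈ S.fixable R, u A ∈ nearValues cs (S.arity R) (t A).toInt := by
  have hsat : ∀ u : Row S R, (ics.all fun ic => !violates ic (rawFact ⟨R, u⟩)) = true ↔
      LocalSat IC u := fun u => by
    simp only [List.all_eq_true, Bool.not_eq_true', ← Bool.not_eq_true, violates_iff, hics]
    exact forall₂_congr fun ic _ => by push Not; rfl
  simp only [candidates, List.mem_filter, List.mem_map, mem_piList]
  constructor
  · rintro ⟨⟨_, ⟨u, hu, rfl⟩, rfl⟩, hs⟩
    have hA : ∀ A ∈ S.fixable R, u A ∈ nearValues cs (S.arity R) (t A).toInt := fun A hA => by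
      simpa [hA] using hu A
    refine ⟨u, rfl, ⟨fun A hA => ?_, fun A hA' => ?_, (hsat u).1 hs⟩, hA⟩
    · simpa [hA] using hu A
    · have := hA A hA'
      simp only [nearValues, List.mem_append, List.mem_map, List.mem_flatMap] at this
      rcases this with ⟨j, -, h⟩ | ⟨c, -, j, -, h⟩
      · exact ⟨_, h.symm⟩
      · exact ⟨_, h.symm⟩
  · rintro ⟨u, rfl, hu, hA⟩
    refine ⟨⟨_, ⟨u, fun A => ?_, rfl⟩, rfl⟩, (hsat u).2 hu.sat⟩
    by_cases h : A ∈ S.fixable R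
    · simpa [h] using hA A h
    · simpa [h] using hu.rigid A h

theorem mem_candidates_of_isLocalLSFix (hics : ∀ ic, ic ∈ ics ↔ ic ∈ IC)
    (hcs : ∀ c, OccursIn IC c → c ∈ cs) {t u : Row S R} (hu : IsLocalLSFix IC t u) :
    rawFact ⟨R, u⟩ ∈ candidates cs ics R (List.ofFn t) := by
  refine (mem_candidates hics).2 ⟨u, rfl, hu.1, fun A hA => ?_⟩
  obtain ⟨z, hz⟩ := hu.1.typed A hA
  obtain ⟨j, hj, h⟩ := hu.value_near hA
  rw [hz] at h ⊢
  simp only [nearValues, List.mem_append, List.mem_map, List.mem_flatMap]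
  rcases h with h | ⟨c, hc, h⟩
  · exact .inl ⟨j, mem_offsets hj, by rw [← h]; rfl⟩
  · exact .inr ⟨c, hcs c hc, j, mem_offsets hj, by rw [← h]; rfl⟩

theorem IsLocalFix.exists_isLocalLSFix {t w : Row S R} (hw : IsLocalFix IC t w) :
    ∃ u, IsLocalLSFix IC t u := by
  classical
  have hex : ∃ d u, IsLocalFix IC t u ∧ rawDist R (List.ofFn t) (List.ofFn u) = d :=
    ⟨_, w, hw, rfl⟩
  obtain ⟨u, hu, hd⟩ := Nat.find_spec hex
  refine ⟨u, hu, fun v hv => ?_⟩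
  rw [← rawDist_ofFn, ← rawDist_ofFn, hd]
  exact_mod_cast Nat.find_min' hex ⟨v, hv, rfl⟩

/-- Minimal among the candidates means minimal among all the local fixes: a global minimizer exists,
as distances are natural numbers, and it is a candidate by `IsLocalLSFix.value_near`. -/
theorem mem_rowBlock (hics : ∀ ic, ic ∈ ics ↔ ic ∈ IC) (hcs : ∀ c, OccursIn IC c → c ∈ cs)
    {t : Row S R} {f : RawFact} : f ∈ rowBlock cs ics R (List.ofFn t) ↔
      ∃ u : Row S R, f = rawFact ⟨R, u⟩ ∧ IsLocalLSFix IC t u := by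
  simp only [rowBlock, List.mem_filter, List.all_eq_true, decide_eq_true_eq]
  constructor
  · rintro ⟨hf, hmin⟩
    obtain ⟨u, rfl, hu, -⟩ := (mem_candidates hics).1 hf
    obtain ⟨v, hv⟩ := hu.exists_isLocalLSFix
    refine ⟨u, rfl, hu, fun w hw => le_trans ?_ (hv.2 w hw)⟩
    rw [← rawDist_ofFn, ← rawDist_ofFn]
    exact_mod_cast hmin _ (mem_candidates_of_isLocalLSFix hics hcs hv)
  · rintro ⟨u, rfl, hu⟩
    refine ⟨mem_candidates_of_isLocalLSFix hics hcs hu, fun g hg => ?_⟩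
    obtain ⟨v, rfl, hv, -⟩ := (mem_candidates hics).1 hg
    have := hu.2 v hv
    rw [← rawDist_ofFn, ← rawDist_ofFn] at this
    exact_mod_cast this

theorem mem_block (hics : ∀ ic, ic ∈ ics ↔ ic ∈ IC) (hcs : ∀ c, OccursIn IC c → c ∈ cs)
    {t : Row S R} {f : RawFact} : f ∈ block cs ics (rawFact ⟨R, t⟩) ↔
      ∃ u : Row S R, f = rawFact ⟨R, u⟩ ∧ IsLocalLSFix IC t u := by
  rw [← mem_rowBlock hics hcs]
  simp only [block, List.mem_flatten, List.mem_map, List.mem_finRange, true_and]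
  constructor
  · rintro ⟨_, ⟨R', rfl⟩, h⟩
    by_cases hR : R = R'
    · subst hR
      rwa [if_pos (show (rawFact ⟨R, t⟩).1 = (R : ℕ) from rfl)] at h
    · rw [if_neg (show ¬ (rawFact ⟨R, t⟩).1 = (R' : ℕ) from fun e => hR (Fin.ext e))] at h
      simp at h
  · intro h
    exact ⟨_, ⟨R, rfl⟩, by rwa [if_pos (show (rawFact ⟨R, t⟩).1 = (R : ℕ) from rfl)]⟩

/-- The number of candidates depends on the arity, the offsets and the number of constants, but not
on the values in the tuple. -/
theorem exists_length_block_le (cs : List ℤ) (ics : List (OneAtomDenial S)) :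
    ∃ K, ∀ f, (block cs ics f).length ≤ K := by
  have h1 : ∀ N, ∃ L, 1 ≤ L ∧ ∀ z, (nearValues cs N z).length ≤ L := fun N =>
    -- The length does not depend on `z`; the extra 1 covers the one-element lists of rigid
    -- attributes.
    ⟨(nearValues cs N 0).length + 1, by omega, fun z => by simp [nearValues]⟩
  choose L hL1 hL using h1
  have h2 : ∀ R t, (rowBlock cs ics R t).length ≤ L (S.arity R) ^ S.arity R := fun R t => by
    refine (List.length_filter_le _ _).trans ((List.length_filter_le _ _).trans ?_)
    rw [List.length_map]
    refine length_piList_le fun A => ?_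
    split_ifs
    · exact hL _ _
    · exact hL1 _
  refine ⟨((List.finRange S.numRel).map fun R => L (S.arity R) ^ S.arity R).sum, fun f => ?_⟩
  rw [block, List.length_flatten, List.map_map]
  refine List.sum_le_sum fun R _ => ?_
  dsimp only [Function.comp]
  split_ifs
  · exact h2 _ _
  · exact Nat.zero_le _

theorem exists_list_occursIn (IC : Finset (OneAtomDenial S)) :
    ∃ cs : List ℤ, ∀ c, OccursIn IC c → c ∈ cs := by
  have hfin : {c | OccursIn IC c}.Finite := by
    -- A finite superset suffices: variables and names merely contribute a superfluous `0`.
    refine Set.Finite.subset (IC.finite_toSet.biUnion (t := fun ic =>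
      Set.range (fun A => ((ic.atom.args A).eval fun _ => .num 0).toInt) ∪
        (fun b : DenialBuiltin ic.n => (b.toCmp.2.2.eval fun _ => .num 0).toInt) ''
          {b | b ∈ ic.builtins}) fun ic _ => ?_) ?_
    · exact (Set.finite_range _).union ((List.finite_toSet _).image _)
    · rintro c ⟨ic, hic, ⟨A, hA⟩ | ⟨θ, x, hb⟩⟩
      · exact Set.mem_biUnion hic (.inl ⟨A, by simp [hA, Trm.eval, Const.toInt]⟩)
      · exact Set.mem_biUnion hic (.inr ⟨_, hb, rfl⟩)
  exact ⟨hfin.toFinset.toList, fun c hc => by simpa using hc⟩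

/-! ### The items of the greedy choice -/

/-- The assignments of values of the facts to the variables that satisfy the comparisons. -/
def queryItems (q : SumQuery S) (fs : List RawFact) : List (List Const) :=
  ((piList fun _ : Fin q.n => fs.flatMap fun f => f.2).dedup).filter (comparisonsHold q.builtins)

/-- The facts that are used by an assignment. -/
def itemFacts (q : SumQuery S) (β : List Const) : List RawFact := q.atoms.map fun a => a.instRaw β

/-- The absolute value of the aggregation variable. -/
def itemWeight (q : SumQuery S) (β : List Const) : ℕ := (β.getD q.aggVar (.num 0)).toInt.natAbs

/-- Writes the answers in all the databases with facts in `fs` as sums over one common list of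
items, so that different LS-fixes can be compared termwise. Removing duplicates ensures that each
assignment counts once. -/
theorem answer_eq_sum (q : SumQuery S) {D : Database S} {fs : List RawFact}
    (hfs : ∀ R, ∀ t ∈ D R, rawFact ⟨R, t⟩ ∈ fs)
    (hnn : ∀ β ∈ q.matches D, ∃ w : ℕ, β q.aggVar = Const.num w)
    (P : List Const → Bool)
    (hP : ∀ β, P β = true ↔ ∀ f ∈ itemFacts q β, ∃ R, ∃ t ∈ D R, f = rawFact ⟨R, t⟩) :
    q.answer D = (((queryItems q fs).map fun β => if P β = true then itemWeight q β else 0).sum :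
      ℕ) := by
  have hnd : (queryItems q fs).Nodup := (List.nodup_dedup _).filter _
  have hmatch : ∀ β : Fin q.n → Const, (∀ f ∈ itemFacts q (List.ofFn β),
      ∃ R, ∃ t ∈ D R, f = rawFact ⟨R, t⟩) ↔ ∀ a ∈ q.atoms, a.Holds D β := fun β => by
    rw [itemFacts, List.forall_mem_map]
    refine forall₂_congr fun a _ => ?_
    rw [DBAtom.instRaw_ofFn]
    constructor
    · rintro ⟨R, t, ht, h⟩
      obtain ⟨rfl, h2⟩ := Sigma.mk.inj_iff.1 (rawFact_injective h)
      rw [DBAtom.Holds, eq_of_heq h2]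
      exact ht
    · intro h
      exact ⟨_, _, h, rfl⟩
  rw [← List.sum_toFinset _ hnd, ← Finset.sum_filter, Nat.cast_sum, SumQuery.answer]
  refine Finset.sum_nbij (fun β => List.ofFn β) (fun β hβ => ?_)
    (fun β _ β' _ h => List.ofFn_injective h) (fun l hl => ?_) fun β hβ => ?_
  · rw [Set.Finite.mem_toFinset] at hβ
    rw [Finset.mem_filter, List.mem_toFinset, queryItems, List.mem_filter, List.mem_dedup,
      mem_piList, hP, hmatch, comparisonsHold_ofFn]
    refine ⟨⟨⟨β, fun x => ?_, rfl⟩, hβ.2⟩, hβ.1⟩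
    obtain ⟨a, ha, A, hA⟩ := q.safe x
    refine List.mem_flatMap.2 ⟨_, hfs _ _ (hβ.1 a ha), ?_⟩
    rw [rawFact, List.mem_ofFn]
    exact ⟨A, by simp [hA, Trm.eval]⟩
  · rw [Finset.mem_coe, Finset.mem_filter, List.mem_toFinset, queryItems, List.mem_filter,
      List.mem_dedup, mem_piList] at hl
    obtain ⟨⟨⟨β, -, rfl⟩, hb⟩, hp⟩ := hl
    rw [hP, hmatch] at hp
    rw [comparisonsHold_ofFn] at hb
    exact ⟨β, by simpa using ⟨hp, hb⟩, rfl⟩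
  · rw [Set.Finite.mem_toFinset] at hβ
    obtain ⟨w, hw⟩ := hnn β hβ
    simp [itemWeight, hw, Const.toInt]

end Raw

/-! ### The approximation algorithm -/

namespace PTime

variable {S : Schema} {n : ℕ} {γ : Type} [DataEnc γ]

theorem evalList {β : γ → List Const} (hβ : PTime β) (τ : Trm n) :
    PTime (fun c => τ.evalList (β c)) := by
  cases τ with
  | var x => exact getD hβ x _
  | const a => exact const a

theorem instRaw {β : γ → List Const} (hβ : PTime β) (a : DBAtom S n) :
    PTime (fun c => a.instRaw (β c)) :=
  (const (a.rel : ℕ)).pair (ofFn fun A => evalList hβ (a.args A))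

theorem holdsBool {f g : γ → Const} (hf : PTime f) (hg : PTime g) (θ : Cmp) :
    PTime (fun c => θ.holdsBool (f c) (g c)) := by
  have h := (isNum hf).and (isNum hg)
  cases θ with
  | eq => exact decide_eq hf hg
  | ne => exact not (decide_eq hf hg)
  | lt => exact h.and (intDecide_lt (toInt hf) (toInt hg))
  | gt => exact h.and (intDecide_lt (toInt hg) (toInt hf))
  | le => exact h.and (not (intDecide_lt (toInt hg) (toInt hf)))
  | ge => exact h.and (not (intDecide_lt (toInt hf) (toInt hg)))

theorem comparisonsHold {β : γ → List Const} (hβ : PTime β) (bs : List (Cmp × Trm n × Trm n)) :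
    PTime (fun c => comparisonsHold bs (β c)) :=
  all_const bs (g := fun c b => b.1.holdsBool (b.2.1.evalList (β c)) (b.2.2.evalList (β c)))
    fun b _ => holdsBool (evalList hβ b.2.1) (evalList hβ b.2.2) b.1

theorem violates {f : γ → RawFact} (hf : PTime f) (ic : OneAtomDenial S) :
    PTime (fun c => violates ic (f c)) :=
  any (piList fun _ => cons (const _) (PTime.snd.comp hf))
    (g := fun c β => decide (ic.atom.instRaw β = f c) &&
      _root_.comparisonsHold (ic.builtins.map DenialBuiltin.toCmp) β)
    ((decide_eq (instRaw PTime.snd ic.atom) (hf.comp PTime.fst)).and (comparisonsHold PTime.snd _))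

theorem nearValues {z : γ → ℤ} (hz : PTime z) (cs : List ℤ) (N : ℕ) :
    PTime (fun c => nearValues cs N (z c)) :=
  append (map_const (offsets N) (g := fun c j => Const.num (z c + j))
    fun j => num (intAdd hz (const j))) (const _)

theorem candidates {t : γ → List Const} (ht : PTime t) (cs : List ℤ)
    (ics : List (OneAtomDenial S)) (R : Fin S.numRel) :
    PTime (fun c => candidates cs ics R (t c)) := by
  refine filter (g := fun _ f => ics.all fun ic => !_root_.violates ic f)
    (map (g := fun _ u => ((R : ℕ), u)) (piList fun A => ?_) ((const _).pair PTime.snd))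
    (all_const ics fun ic _ => not (violates PTime.snd ic))
  by_cases hA : A ∈ S.fixable R
  · simp only [hA, if_true]
    exact nearValues (toInt (getD ht A _)) cs _
  · simp only [hA, if_false]
    exact cons (getD ht A _) (const _)

theorem rawDist {t u : γ → List Const} (ht : PTime t) (hu : PTime u) (R : Fin S.numRel) :
    PTime (fun c => rawDist R (t c) (u c)) := by
  refine sum (ofFn fun A => ?_)
  by_cases hA : A ∈ S.fixable R
  · simp only [hA, if_true]
    have h := natAbs (intSub (toInt (getD ht A (.num 0))) (toInt (getD hu A (.num 0))))
    exact mul h h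
  · simp only [hA, if_false]
    exact const 0

theorem rowBlock {t : γ → List Const} (ht : PTime t) (cs : List ℤ) (ics : List (OneAtomDenial S))
    (R : Fin S.numRel) : PTime (fun c => rowBlock cs ics R (t c)) := by
  have hc := candidates ht cs ics R
  refine filter hc (g := fun c (f : RawFact) => (_root_.candidates cs ics R (t c)).all fun g =>
    decide (_root_.rawDist R (t c) f.2 ≤ _root_.rawDist R (t c) g.2)) ?_
  refine all (hc.comp PTime.fst) (g := fun (c : γ × RawFact) (g : RawFact) =>
    decide (_root_.rawDist R (t c.1) c.2.2 ≤ _root_.rawDist R (t c.1) g.2)) ?_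
  have ht' : PTime (fun c : (γ × RawFact) × RawFact => t c.1.1) :=
    ht.comp (PTime.fst.comp PTime.fst)
  exact decide_le (rawDist ht' (PTime.snd.comp (PTime.snd.comp PTime.fst)) R)
    (rawDist ht' (PTime.snd.comp PTime.snd) R)

theorem block {f : γ → RawFact} (hf : PTime f) (cs : List ℤ) (ics : List (OneAtomDenial S)) :
    PTime (fun c => block cs ics (f c)) :=
  flatten (map_const (List.finRange S.numRel) (g := fun c (R : Fin S.numRel) =>
    if (f c).1 = (R : ℕ) then _root_.rowBlock cs ics R (f c).2 else [])
    fun R => ite_prop (decide_eq (PTime.fst.comp hf) (const _))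
      (rowBlock (PTime.snd.comp hf) cs ics R) (const _))

theorem queryItems {fs : γ → List RawFact} (hfs : PTime fs) (q : SumQuery S) :
    PTime (fun c => queryItems q (fs c)) :=
  filter (g := fun _ β => _root_.comparisonsHold q.builtins β)
    (dedup (piList fun _ => flatMap hfs (g := fun _ f => f.2) (PTime.snd.comp PTime.snd)))
    (comparisonsHold PTime.snd _)

theorem itemFacts {β : γ → List Const} (hβ : PTime β) (q : SumQuery S) :
    PTime (fun c => itemFacts q (β c)) :=
  map_const q.atoms (g := fun c a => a.instRaw (β c)) fun a => instRaw hβ a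

theorem itemWeight {β : γ → List Const} (hβ : PTime β) (q : SumQuery S) :
    PTime (fun c => itemWeight q (β c)) :=
  natAbs (toInt (getD hβ q.aggVar _))

theorem compatible {α : Type} [DataEnc α] [DecidableEq α] {Bs : γ → List (List α)}
    {l l' : γ → List α} (hB : PTime Bs) (hl : PTime l) (hl' : PTime l') :
    PTime (fun c => compatible (Bs c) (l c) (l' c)) := by
  refine all hB (g := fun c B => (l c).all fun f => (l' c).all fun g =>
    !(decide (f ∈ B) && decide (g ∈ B)) || decide (f = g)) ?_
  refine all (hl.comp PTime.fst) (g := fun (c : γ × List α) f => (l' c.1).all fun g =>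
    !(decide (f ∈ c.2) && decide (g ∈ c.2)) || decide (f = g)) ?_
  refine all (hl'.comp (PTime.fst.comp PTime.fst)) (g := fun (c : (γ × List α) × α) g =>
    !(decide (c.2 ∈ c.1.2) && decide (g ∈ c.1.2)) || decide (c.2 = g)) ?_
  have hB' : PTime (fun c : ((γ × List α) × α) × α => c.1.1.2) :=
    PTime.snd.comp (PTime.fst.comp PTime.fst)
  have hf : PTime (fun c : ((γ × List α) × α) × α => c.1.2) := PTime.snd.comp PTime.fst
  exact (not ((decide_mem hf hB').and (decide_mem PTime.snd hB'))).or (decide_eq hf PTime.snd)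

theorem allMem {α : Type} [DataEnc α] [DecidableEq α] {l l' : γ → List α} (hl : PTime l)
    (hl' : PTime l') : PTime (fun c => allMem (l c) (l' c)) :=
  all hl (g := fun c f => decide (f ∈ l' c)) (decide_mem PTime.snd (hl'.comp PTime.fst))

theorem admissible {α : Type} [DataEnc α] [DecidableEq α] {Bs : γ → List (List α)}
    {dec l : γ → List α} (hB : PTime Bs) (hd : PTime dec) (hl : PTime l) :
    PTime (fun c => admissible (Bs c) (dec c) (l c)) :=
  ((allMem hl (flatten hB)).and (compatible hB hl hl)).and
      (compatible hB hl hd)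

theorem weight {dec : γ → List RawFact} {β : γ → List Const} (hd : PTime dec) (hβ : PTime β)
    (k : ℕ) (q : SumQuery S) : PTime (fun c => weight k (dec c) (_root_.itemFacts q (β c))) := by
  unfold _root_.weight _root_.itemFacts
  induction q.atoms with
  | nil => exact const 1
  | cons a l ih =>
    simp only [List.map_cons, List.prod_cons]
    exact mul (ite_prop (decide_mem (instRaw hβ a) hd) (const k) (const 1)) ih

theorem potential {Bs : γ → List (List RawFact)} {items : γ → List (List Const)}
    {dec : γ → List RawFact} (hB : PTime Bs) (hi : PTime items) (hd : PTime dec) (k : ℕ)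
    (q : SumQuery S) : PTime (fun c => potential (Bs c) k (items c) (_root_.itemFacts q)
      (_root_.itemWeight q) (dec c)) := by
  refine sum (map hi (g := fun c i => if _root_.admissible (Bs c) (dec c)
    (_root_.itemFacts q i) = true then
      _root_.weight k (dec c) (_root_.itemFacts q i) * _root_.itemWeight q i else 0) ?_)
  exact ite (admissible (hB.comp PTime.fst) (hd.comp PTime.fst) (itemFacts PTime.snd q))
    (mul (weight (hd.comp PTime.fst) PTime.snd k q) (itemWeight PTime.snd q)) (const 0)

theorem greedyStep {Bs : γ → List (List RawFact)} {items : γ → List (List Const)}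
    {B dec : γ → List RawFact} (hB : PTime Bs) (hi : PTime items) (hb : PTime B) (hd : PTime dec)
    (k : ℕ) (q : SumQuery S) : PTime (fun c => greedyStep (Bs c) k (items c) (_root_.itemFacts q)
      (_root_.itemWeight q) (B c) (dec c)) := by
  refine append (take_one (filter hb (g := fun c f => (B c).all fun g => decide
    (_root_.potential (Bs c) k (items c) (_root_.itemFacts q) (_root_.itemWeight q) (g :: dec c) ≤
      _root_.potential (Bs c) k (items c) (_root_.itemFacts q) (_root_.itemWeight q)
        (f :: dec c))) ?_)) hd
  refine all (hb.comp PTime.fst) (g := fun (c : γ × RawFact) g => decide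
    (_root_.potential (Bs c.1) k (items c.1) (_root_.itemFacts q) (_root_.itemWeight q)
      (g :: dec c.1) ≤ _root_.potential (Bs c.1) k (items c.1) (_root_.itemFacts q)
        (_root_.itemWeight q) (c.2 :: dec c.1))) ?_
  have h : PTime (fun c : (γ × RawFact) × RawFact => c.1.1) := PTime.fst.comp PTime.fst
  exact decide_le (potential (hB.comp h) (hi.comp h) (cons PTime.snd (hd.comp h)) k q)
    (potential (hB.comp h) (hi.comp h) (cons (PTime.snd.comp PTime.fst) (hd.comp h)) k q)

theorem greedy {Bs : γ → List (List RawFact)} {items : γ → List (List Const)} (hB : PTime Bs)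
    (hi : PTime items) (k : ℕ) (q : SumQuery S) : PTime (fun c => greedy (Bs c) k (items c)
      (_root_.itemFacts q) (_root_.itemWeight q)) := by
  refine foldr hB (init := fun _ => []) (step := fun c B r => _root_.greedyStep (Bs c) k (items c)
    (_root_.itemFacts q) (_root_.itemWeight q) B r)
    (greedyStep (hB.comp PTime.fst) (hi.comp PTime.fst) (PTime.fst.comp PTime.snd)
      (PTime.snd.comp PTime.snd) k q) (const _) ⟨Polynomial.X, fun c l => ?_⟩
  -- Every step adds at most a sublist of its block, so the choices are never larger than the list
  -- of blocks.
  have : esize (l.foldr (fun B r => _root_.greedyStep (Bs c) k (items c)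
      (_root_.itemFacts q) (_root_.itemWeight q) B r) []) ≤ esize l := by
    induction l with
    | nil => exact le_rfl
    | cons B l ih =>
      rw [List.foldr_cons, esize_cons, _root_.greedyStep]
      refine (Nat.le_succ _).trans ((esize_append _ _).le.trans ?_)
      have := esize_le_of_sublist ((List.take_sublist 1 _).trans (List.filter_sublist (l := B)
        (p := fun f => B.all fun g => decide (_root_.potential (Bs c) k (items c)
          (_root_.itemFacts q) (_root_.itemWeight q) (g :: l.foldr (fun B r => _root_.greedyStep
            (Bs c) k (items c) (_root_.itemFacts q) (_root_.itemWeight q) B r) []) ≤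
          _root_.potential (Bs c) k (items c) (_root_.itemFacts q) (_root_.itemWeight q)
            (f :: l.foldr (fun B r => _root_.greedyStep (Bs c) k (items c) (_root_.itemFacts q)
              (_root_.itemWeight q) B r) [])))))
      omega
  rw [Polynomial.eval_X, esize_pair]
  dsimp only
  omega

end PTime

/-! ### The assembled algorithm -/

section Algorithm
variable {S : Schema} (cs : List ℤ) (ics : List (OneAtomDenial S)) (k : ℕ) (q : SumQuery S)

/-- The fixes of the facts. -/
def factBlocks (l : List RawFact) : List (List RawFact) := l.map (block cs ics)

/-- The items of the query over the fixes of the facts. -/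
def blockItems (l : List RawFact) : List (List Const) :=
  queryItems q (factBlocks cs ics l).flatten

/-- The chosen fixes. -/
def chosenFacts (l : List RawFact) : List RawFact :=
  greedy (factBlocks cs ics l) k (blockItems cs ics q l) (itemFacts q) (itemWeight q)

/-- The answer to the query in the database of the chosen fixes. -/
def chosenValue (l : List RawFact) : ℕ :=
  ((blockItems cs ics q l).map fun β => if allMem (itemFacts q β)
    (chosenFacts cs ics k q l) = true then itemWeight q β else 0).sum

theorem ptime_chosen : PTime (fun l : List RawFact =>
    (chosenFacts cs ics k q l, (chosenValue cs ics k q l : ℤ))) := by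
  have hB : PTime (factBlocks cs ics) :=
    PTime.map PTime.id (g := fun _ f => block cs ics f) (PTime.block PTime.snd cs ics)
  have hi : PTime (blockItems cs ics q) := PTime.queryItems (PTime.flatten hB) q
  have hd : PTime (chosenFacts cs ics k q) := PTime.greedy hB hi k q
  refine hd.pair (PTime.natCast (PTime.sum (PTime.map hi (g := fun l β =>
    if allMem (itemFacts q β) (chosenFacts cs ics k q l) = true then
      itemWeight q β else 0) ?_)))
  exact PTime.ite (PTime.allMem (PTime.itemFacts PTime.snd q) (hd.comp PTime.fst))
    (PTime.itemWeight PTime.snd q) (PTime.const 0)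

end Algorithm

/-- Untyped facts have the prescribed encoding, so a program on them is a program on databases. -/
theorem enc_map_rawFact {S : Schema} (l : List (DBFact S)) : enc (l.map rawFact) = encodeFacts l := by
  induction l with
  | nil => rfl
  | cons f l ih =>
    rw [List.map_cons, enc_cons, ih]
    rfl

/-- Turns a list of choices into a choice function; without repetitions, no index receives two
values. -/
theorem List.Forall₂.exists_eq_map {α β ι : Type} [Inhabited α] {r : α → β → Prop} {h : ι → β}
    {l : List ι} (hl : l.Nodup) {l' : List α} (H : List.Forall₂ r l' (l.map h)) :
    ∃ φ : ι → α, l' = l.map φ ∧ ∀ i ∈ l, r (φ i) (h i) := by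
  classical
  induction l generalizing l' with
  | nil =>
    rw [List.map_nil, List.forall₂_nil_right_iff] at H
    exact ⟨fun _ => default, by simp [H]⟩
  | cons i l ih =>
    obtain ⟨hi, hl⟩ := List.nodup_cons.1 hl
    obtain ⟨a, l', ha, H', rfl⟩ := List.forall₂_cons_right_iff.1 H
    obtain ⟨φ, rfl, hφ⟩ := ih hl H'
    have hne : ∀ j ∈ l, j ≠ i := fun j hj e => hi (e ▸ hj)
    refine ⟨Function.update φ i a, ?_, fun j hj => ?_⟩
    · rw [List.map_cons, Function.update_self]
      congr 1
      exact List.map_congr_left fun j hj => (Function.update_of_ne (hne j hj) _ _).symm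
    · rcases List.mem_cons.1 hj with rfl | hj
      · rwa [Function.update_self]
      · rw [Function.update_of_ne (hne j hj)]
        exact hφ j hj

/-! ### Correctness and the approximation factor -/

section Correctness
variable {S : Schema} {IC : Finset (OneAtomDenial S)} {cs : List ℤ} {ics : List (OneAtomDenial S)}

theorem exists_boundsTupleFixes (IC : Finset (OneAtomDenial S)) : ∃ K, BoundsTupleFixes IC K := by
  obtain ⟨cs, hcs⟩ := exists_list_occursIn IC
  obtain ⟨K, hK⟩ := exists_length_block_le cs IC.toList
  refine ⟨K, fun D hD R t ht => ?_⟩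
  have hinj : Function.Injective fun u : Row S R => rawFact ⟨R, u⟩ := fun u u' h =>
    eq_of_heq (Sigma.mk.inj_iff.1 (rawFact_injective h)).2
  rw [← hinj.encard_image]
  have hsub : (fun u : Row S R => rawFact ⟨R, u⟩) '' tupleFixes IC D t ⊆
      ((block cs IC.toList (rawFact ⟨R, t⟩)).toFinset : Set RawFact) := by
    rintro _ ⟨u, hu, rfl⟩
    rw [Finset.mem_coe, List.mem_toFinset]
    exact (mem_block (fun _ => Finset.mem_toList) hcs).2
      ⟨u, rfl, isLocalLSFix_of_mem_tupleFixes hD ht hu⟩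
  refine (Set.encard_le_encard hsub).trans ?_
  rw [Set.encard_coe_eq_coe_finsetCard]
  exact_mod_cast (List.toFinset_card_le _).trans (hK _)

/-- When an LS-fix exists, all the elements of a block are fixes of the tuple. So its size is at
most any uniform bound `k`, in particular the least one, and not just the crude number of
candidates. -/
theorem card_block_le (hics : ∀ ic, ic ∈ ics ↔ ic ∈ IC) (hcs : ∀ c, OccursIn IC c → c ∈ cs)
    {k : ℕ} (hk : BoundsTupleFixes IC k) {D : Database S} (hD : IsInstance D)
    (hex : ∃ D', IsLSFix IC D D') {R : Fin S.numRel} {t : Row S R} (ht : t ∈ D R) :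
    (block cs ics (rawFact ⟨R, t⟩)).toFinset.card ≤ k := by
  have hsub : ((block cs ics (rawFact ⟨R, t⟩)).toFinset : Set RawFact) ⊆
      (fun u : Row S R => rawFact ⟨R, u⟩) '' tupleFixes IC D t := by
    intro f hf
    rw [Finset.mem_coe, List.mem_toFinset] at hf
    obtain ⟨u, rfl, hu⟩ := (mem_block hics hcs).1 hf
    exact ⟨u, mem_tupleFixes hD hex ht hu, rfl⟩
  have := (Set.encard_le_encard hsub).trans
    ((Set.encard_image_le _ _).trans (hk D hD R t ht))
  rw [Set.encard_coe_eq_coe_finsetCard] at this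
  exact_mod_cast this

/-- The chosen facts form a fix of least distance, whose answer approximates the others. -/
theorem chosen_spec (hics : ∀ ic, ic ∈ ics ↔ ic ∈ IC) (hcs : ∀ c, OccursIn IC c → c ∈ cs)
    {k : ℕ} (hk : BoundsTupleFixes IC k) {D : Database S} (hD : IsInstance D)
    {l : List (DBFact S)} (hl : ListsFacts l D) (hex : ∃ D', IsLSFix IC D D') (q : SumQuery S)
    (hnn : q.NonnegOn IC D) :
    ∃ (D' : Database S) (l' : List (DBFact S)),
      chosenFacts cs ics k q (l.map rawFact) = l'.map rawFact ∧ ListsFacts l' D' ∧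
      IsLSFix IC D D' ∧ q.answer D' = chosenValue cs ics k q (l.map rawFact) ∧
      ∀ D'', IsLSFix IC D D'' →
        q.answer D'' ≤ (k : ℤ) ^ q.atoms.length * chosenValue cs ics k q (l.map rawFact) := by
  have hblocks : factBlocks cs ics (l.map rawFact) = l.map fun f => block cs ics (rawFact f) := by
    rw [factBlocks, List.map_map]; rfl
  have hmemBlock : ∀ f ∈ l, ∀ r, r ∈ block cs ics (rawFact f) ↔
      ∃ u : Row S f.1, r = rawFact ⟨f.1, u⟩ ∧ IsLocalLSFix IC f.2 u := fun f _ r =>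
    mem_block hics hcs
  -- A replacement keeps the key and thereby determines the original tuple; hence the blocks are
  -- disjoint.
  have hkey : ∀ f ∈ l, ∀ f' ∈ l, ∀ r, r ∈ block cs ics (rawFact f) →
      r ∈ block cs ics (rawFact f') → f = f' := by
    rintro ⟨R, t⟩ hf ⟨R', t'⟩ hf' r hr hr'
    obtain ⟨u, rfl, hu⟩ := (hmemBlock _ hf _).1 hr
    obtain ⟨u', h, hu'⟩ := (hmemBlock _ hf' _).1 hr'
    obtain ⟨h1, h2⟩ := Sigma.mk.inj_iff.1 (rawFact_injective h)
    dsimp only at h1 h2 hu hu'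
    subst h1
    obtain rfl := eq_of_heq h2
    rw [hD.keys R t ((hl.2 R t).1 hf) t' ((hl.2 R t').1 hf')
      (hu.1.sameKey.trans hu'.1.sameKey.symm)]
  have hdisj : (factBlocks cs ics (l.map rawFact)).Pairwise List.Disjoint := by
    rw [hblocks, List.pairwise_map]
    refine hl.1.imp_of_mem fun hf hf' hne r hr hr' => hne (hkey _ hf _ hf' r hr hr')
  have hLS : ∀ g : ∀ R, Row S R → Row S R, (∀ R, ∀ t ∈ D R, IsLocalLSFix IC t (g R t)) →
      ∀ f ∈ l, rawFact ⟨f.1, g f.1 f.2⟩ ∈ block cs ics (rawFact f) := fun g hg f hf =>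
    (hmemBlock f hf _).2 ⟨_, rfl, hg _ _ ((hl.2 _ _).1 hf)⟩
  have hflat : ∀ g : ∀ R, Row S R → Row S R, (∀ R, ∀ t ∈ D R, IsLocalLSFix IC t (g R t)) →
      ∀ R, ∀ u ∈ replaceRows D g R,
        rawFact ⟨R, u⟩ ∈ (factBlocks cs ics (l.map rawFact)).flatten := by
    intro g hg R u hu
    obtain ⟨t, ht, rfl⟩ := mem_replaceRows.1 hu
    rw [hblocks]
    exact List.mem_flatten.2 ⟨_, List.mem_map.2 ⟨⟨R, t⟩, (hl.2 R t).2 ht, rfl⟩,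
      hLS g hg ⟨R, t⟩ ((hl.2 R t).2 ht)⟩
  obtain ⟨hsel, hval⟩ := greedy_spec (k := k) (m := q.atoms.length)
    (blockItems cs ics q (l.map rawFact)) (itemFacts q) (itemWeight q) hdisj (fun B hB => by
      rw [hblocks] at hB
      obtain ⟨f, hf, rfl⟩ := List.mem_map.1 hB
      have hfD := (hl.2 f.1 f.2).1 hf
      obtain ⟨D₀, hD₀⟩ := hex
      obtain ⟨g, hg, rfl⟩ := hD₀.exists_replaceRows hD
      exact ⟨List.ne_nil_of_mem (hLS g hg f hf), card_block_le hics hcs hk hD ⟨_, hD₀⟩ hfD⟩)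
    (fun β => by simp [itemFacts])
  change List.Forall₂ _ (chosenFacts cs ics k q (l.map rawFact)) _ at hsel
  change _ ≤ k ^ q.atoms.length * chosenValue cs ics k q (l.map rawFact) at hval
  rw [hblocks] at hsel
  obtain ⟨φ, hφ, hφ'⟩ := hsel.exists_eq_map hl.1
  have hex' : ∀ R, ∀ t ∈ D R, ∃ u : Row S R, φ ⟨R, t⟩ = rawFact ⟨R, u⟩ ∧ IsLocalLSFix IC t u :=
    fun R t ht => (hmemBlock ⟨R, t⟩ ((hl.2 R t).2 ht) _).1 (hφ' _ ((hl.2 R t).2 ht))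
  choose! g hg hg' using hex'
  have hdec : chosenFacts cs ics k q (l.map rawFact) =
      (l.map fun f => (⟨f.1, g f.1 f.2⟩ : DBFact S)).map rawFact := by
    rw [hφ, List.map_map]
    exact List.map_congr_left fun f hf => hg f.1 f.2 ((hl.2 _ _).1 hf)
  have hlist : ListsFacts (l.map fun f => (⟨f.1, g f.1 f.2⟩ : DBFact S)) (replaceRows D g) := by
    refine ⟨(List.nodup_map_iff_inj_on hl.1).2 fun f hf f' hf' h => ?_, fun R u => ?_⟩
    · exact hkey f hf f' hf' _ (hLS g hg' f hf) (by rw [h]; exact hLS g hg' f' hf')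
    · rw [List.mem_map, mem_replaceRows]
      constructor
      · rintro ⟨⟨R', t⟩, hf, h⟩
        obtain ⟨h1, h2⟩ := Sigma.mk.inj_iff.1 h
        dsimp only at h1 h2
        subst h1
        exact ⟨t, (hl.2 _ _).1 hf, eq_of_heq h2⟩
      · rintro ⟨t, ht, rfl⟩
        exact ⟨⟨R, t⟩, (hl.2 R t).2 ht, rfl⟩
  have hfix := isLSFix_replaceRows hD hg'
  refine ⟨_, _, hdec, hlist, hfix, ?_, fun D'' hD'' => ?_⟩
  · refine answer_eq_sum q (hflat g hg') (hnn _ hfix) _ fun β => ?_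
    rw [allMem_iff]
    refine forall₂_congr fun f _ => ?_
    rw [hdec, List.mem_map]
    constructor
    · rintro ⟨⟨R, u⟩, hu, rfl⟩
      exact ⟨R, u, (hlist.2 R u).1 hu, rfl⟩
    · rintro ⟨R, u, hu, rfl⟩
      exact ⟨_, (hlist.2 R u).2 hu, rfl⟩
  · classical
    obtain ⟨g₂, hg₂, rfl⟩ := hD''.exists_replaceRows hD
    rw [answer_eq_sum q (hflat g₂ hg₂) (hnn _ hD'') (fun β => decide (∀ f ∈ itemFacts q β,
      ∃ R, ∃ t ∈ replaceRows D g₂ R, f = rawFact ⟨R, t⟩)) fun β => decide_eq_true_iff]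
    have hval' := (Nat.cast_le (α := ℤ)).2 hval
    rw [Nat.cast_mul, Nat.cast_pow] at hval'
    refine le_trans ?_ hval'
    refine Nat.cast_le.2 (List.sum_le_sum fun β _ => ?_)
    split_ifs with h1 h2
    · exact le_rfl
    -- An item true in `D''` is admissible: its facts lie in blocks, and two of them in one block
    -- share a key, so they coincide in `D''`.
    · refine absurd ?_ h2
      rw [decide_eq_true_eq] at h1
      simp only [admissible, allMem_iff, Bool.and_eq_true, compatible_iff]
      refine ⟨⟨fun f hf => ?_, fun B hB f hf f' hf' hfB hfB' => ?_⟩, by simp⟩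
      · obtain ⟨R, u, hu, rfl⟩ := h1 f hf
        exact hflat g₂ hg₂ R u hu
      · rw [hblocks] at hB
        obtain ⟨f₀, hf₀, rfl⟩ := List.mem_map.1 hB
        obtain ⟨R, u, hu, rfl⟩ := h1 f hf
        obtain ⟨R', u', hu', rfl⟩ := h1 f' hf'
        obtain ⟨v, e, hv⟩ := (hmemBlock _ hf₀ _).1 hfB
        obtain ⟨v', e', hv'⟩ := (hmemBlock _ hf₀ _).1 hfB'
        have e := rawFact_injective e
        have e' := rawFact_injective e'
        obtain ⟨rfl, e2⟩ := Sigma.mk.inj_iff.1 e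
        obtain ⟨rfl, e2'⟩ := Sigma.mk.inj_iff.1 e'
        obtain rfl := eq_of_heq e2
        obtain rfl := eq_of_heq e2'
        rw [hD''.1.isInstance.keys _ _ hu _ hu' (hv.1.sameKey.symm.trans hv'.1.sameKey)]
    · exact Nat.zero_le _
    · exact le_rfl

end Correctness

theorem mainTheorem12 (S : Schema) (IC : Finset (OneAtomDenial S)) (q : SumQuery S) :
    ∃ k : ℕ, IsLeast {j : ℕ | BoundsTupleFixes IC j} k ∧
      ∃ (P : Program) (p : Polynomial ℕ),
        ∀ (D : Database S) (l : List (DBFact S)), IsInstance D → ListsFacts l D →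
          ∃ (out : Data) (s : ℕ),
            P.Runs (encodeFacts l) out s ∧ s ≤ p.eval (encodeFacts l).size ∧
            ((∃ D', IsLSFix IC D D') → q.NonnegOn IC D →
              ∃ (D' : Database S) (l' : List (DBFact S)) (v a : ℤ),
                out = Data.cons (encodeFacts l') (encodeInt v) ∧ ListsFacts l' D' ∧
                IsLSFix IC D D' ∧ q.answer D' = v ∧
                q.IsMinMaxAnswer IC D a ∧ v ≤ a ∧ a ≤ (k : ℤ) ^ q.atoms.length * v) := by
  classical
  have hbound := exists_boundsTupleFixes IC
  obtain ⟨cs, hcs⟩ := exists_list_occursIn IC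
  refine ⟨Nat.find hbound, ⟨Nat.find_spec hbound, fun j hj => Nat.find_min' hbound hj⟩, ?_⟩
  set k := Nat.find hbound with hk
  -- The number `k`, the constants, the denials and the query are built into the program. It halts
  -- on every input, even if there is no LS-fix.
  obtain ⟨P, p, hP⟩ := (ptime_chosen cs IC.toList k q).exists_program
  refine ⟨P, p, fun D l hD hl => ?_⟩
  obtain ⟨s, hs, hrun⟩ := hP (l.map rawFact)
  rw [esize, enc_map_rawFact] at hs
  rw [enc_map_rawFact] at hrun
  refine ⟨_, s, hrun, hs, fun hex hnn => ?_⟩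
  obtain ⟨D', l', h1, h2, h3, h4, h5⟩ := chosen_spec (fun _ => Finset.mem_toList) hcs
    (Nat.find_spec hbound) hD hl hex q hnn
  have hne : {v | ∃ D', IsLSFix IC D D' ∧ q.answer D' = v}.Nonempty := ⟨_, D', h3, rfl⟩
  have hub : (k : ℤ) ^ q.atoms.length * chosenValue cs IC.toList k q (l.map rawFact) ∈
      upperBounds {v | ∃ D', IsLSFix IC D D' ∧ q.answer D' = v} := by
    rintro _ ⟨D'', hD'', rfl⟩
    exact h5 D'' hD''
  -- The approximation bound also shows that the set of answers is bounded above, so its supremum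
  -- exists in `ℤ`.
  have hlub := isLUB_csSup hne ⟨_, hub⟩
  refine ⟨D', l', _, _, ?_, h2, h3, h4, hlub, hlub.1 ⟨D', h3, h4⟩, hlub.2 hub⟩
  rw [enc_pair, h1, enc_map_rawFact]
  rfl
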